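/- Define the Mandelbrot polynomials $M_n(y)\in\mathbb{Q}[y]$, $n\ge 1$, recursively by $$M_n(y)=\begin{cases}y&\text{if } n=1,\\ -\frac12\sum_{i=1}^{n-1} M_i(y) M_{n-i}(y)&\text{if } n>1 \text{ is odd},\\ \frac12 M_{n/2}(y)-\frac12\sum_{i=1}^{n-1} M_i(y) M_{n-i}(y)&\text{if } n>1 \text{ is even}.\end{cases}$$ (Equivalently, for each $c \in \mathbb{C}$ the formal power series $g_c(z)=1+\sum_{n\ge1}M_n(c)z^n$ satisfies $g_c(z)^2=g_c(z^2)+2cz$.) Let $\mathcal{M}\subset\mathbb{C}$ be the Mandelbrot set, i.e. the set of all $c\in\mathbb{C}$ for which the orbit of $0$ under $z\mapsto z^2+c$ is bounded. **Theorem.** For every open set $U\subseteq\mathbb{C}$ containing $\mathcal{M}$ there exists an integer $N$ such that for all $n>N$ and all $c\in\mathbb{C}\setminus U$, $M_n(-c/2)\neq 0$. -/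

import Mathlib

open Polynomial

/-- The Mandelbrot set: all complex `c` such that the orbit of `0` under `z ↦ z ^ 2 + c`
is bounded. -/
def mandelbrotSet : Set ℂ :=
  {c | Bornology.IsBounded (Set.range fun n : ℕ => (fun z : ℂ => z ^ 2 + c)^[n] 0)}

/-- The Mandelbrot polynomials `M_n(y)` over `ℚ`. They are indexed by `n ≥ 1`; the value at `0` is
a placeholder, which is not used by the recursion. See `mandelbrotPoly_of_even` and
`mandelbrotPoly_of_odd` for the recursion in its usual form. -/
noncomputable def mandelbrotPoly : ℕ → ℚ[X]
  | 0 => 0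
  | 1 => X
  | n + 2 =>
    (if Even (n + 2) then C (1 / 2) * mandelbrotPoly ((n + 2) / 2) else 0)
      - C (1 / 2) * ∑ i : Fin (n + 1), mandelbrotPoly (i + 1) * mandelbrotPoly (n + 1 - i)
decreasing_by all_goals omega

theorem mandelbrotPoly_one : mandelbrotPoly 1 = X := by
  rw [mandelbrotPoly]

theorem mandelbrotPoly_of_odd {n : ℕ} (hn : 1 < n) (h : Odd n) :
    mandelbrotPoly n =
      - (C (1 / 2) * ∑ i ∈ Finset.Icc 1 (n - 1), mandelbrotPoly i * mandelbrotPoly (n - i)) := by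
  obtain ⟨m, rfl⟩ : ∃ m, n = m + 2 := ⟨n - 2, by omega⟩
  rw [mandelbrotPoly, if_neg (Nat.not_even_iff_odd.mpr h), zero_sub,
    Fin.sum_univ_eq_sum_range (fun i => mandelbrotPoly (i + 1) * mandelbrotPoly (m + 1 - i)),
    Finset.sum_bij (fun i _ => i + 1)]
  · intro i hi
    simp only [Finset.mem_range, Finset.mem_Icc] at *
    omega
  · intro i _ j _ hij
    omega
  · intro j hj
    simp only [Finset.mem_Icc] at hj
    exact ⟨j - 1, Finset.mem_range.mpr (by omega), by omega⟩
  · intro i _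
    rw [show m + 2 - (i + 1) = m + 1 - i by omega]

theorem mandelbrotPoly_of_even {n : ℕ} (hn : 1 < n) (h : Even n) :
    mandelbrotPoly n =
      C (1 / 2) * mandelbrotPoly (n / 2) -
        C (1 / 2) * ∑ i ∈ Finset.Icc 1 (n - 1), mandelbrotPoly i * mandelbrotPoly (n - i) := by
  obtain ⟨m, rfl⟩ : ∃ m, n = m + 2 := ⟨n - 2, by omega⟩
  rw [mandelbrotPoly, if_pos h,
    Fin.sum_univ_eq_sum_range (fun i => mandelbrotPoly (i + 1) * mandelbrotPoly (m + 1 - i)),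
    Finset.sum_bij (fun i _ => i + 1)]
  · intro i hi
    simp only [Finset.mem_range, Finset.mem_Icc] at *
    omega
  · intro i _ j _ hij
    omega
  · intro j hj
    simp only [Finset.mem_Icc] at hj
    exact ⟨j - 1, Finset.mem_range.mpr (by omega), by omega⟩
  · intro i _
    rw [show m + 2 - (i + 1) = m + 1 - i by omega]

/-! Put `t = 1/c`. Up to the factor `c ^ n`, `M_n(-c/2)` is the `n`-th coefficient of the series
`g_t` with `g_t(u)^2 = g_t(t u^2) - u` (`aeval_mandelbrotPoly`, `gen_sq`), and `c = ∞` becomes the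
ordinary parameter `t = 0`. The theorem follows from singularity analysis of `g_t`, locally uniform
in `t`.

If `g_t` is analytic for `|u| < s`, then `F_t(y) = g_t(t y^2) - y` is analytic where `|t| |y|^2 <
s`, and `g_t = √F_t` extends until a zero of `F_t` is met (`UniformRadius.extend`). With `A(y) =
g_t(t y^2)`, the map `ψ(y) = A(y)/(t y)` satisfies `ψ(t y^2) = ψ(y)^2 + c`, so it inverts the
Böttcher coordinate, and `F_t(y) = 0` says `ψ(y) = c`. For `c` outside the Mandelbrot set the
critical value escapes, which gives such a zero with `|t y| < 1` (`exists_zero_gen_mul_sq_sub`); it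
is unique and simple (`eq_of_isFixedPt`, `deriv_ne_one_of_isFixedPt`).

Calling the zero `a`, `g_t(u) = K(u) √(1 - u/a)` with `K` analytic beyond `|a|` and `K(a) ≠ 0`.
Hence the coefficients of `g_t(a u)` are asymptotic to `K(a)` times those of `√(1 - u)`, none of
which vanish. This holds uniformly for `t` near `t₀` (`eventually_scaledCoeff_ne_zero`), and the
admissible `t` form a compact set. -/

namespace MandelbrotPoly

open Filter Topology Metric

/-! ### Taylor series at the origin -/

/-- The Taylor series at the origin of a complex function. -/
noncomputable def taylorSeries (f : ℂ → ℂ) : PowerSeries ℂ :=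
  PowerSeries.mk fun n => iteratedDeriv n f 0 / n.factorial

theorem taylorSeries_congr {f g : ℂ → ℂ} (h : f =ᶠ[𝓝 0] g) : taylorSeries f = taylorSeries g := by
  ext n
  simp [taylorSeries, h.iteratedDeriv_eq]

theorem taylorSeries_mul {f g : ℂ → ℂ} (hf : AnalyticAt ℂ f 0) (hg : AnalyticAt ℂ g 0) :
    taylorSeries (f * g) = taylorSeries f * taylorSeries g := by
  ext n
  simp only [taylorSeries, PowerSeries.coeff_mk, iteratedDeriv_mul hf.contDiffAt hg.contDiffAt,
    PowerSeries.coeff_mul, Finset.Nat.sum_antidiagonal_eq_sum_range_succ_mk, Finset.sum_div,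
    Nat.succ_eq_add_one]
  refine Finset.sum_congr rfl fun i hi => ?_
  rw [Nat.cast_choose _ (by grind)]
  field_simp [Nat.factorial_ne_zero]

theorem hasSum_taylorSeries {f : ℂ → ℂ} {r : ℝ} (hf : DifferentiableOn ℂ f (ball 0 r)) {z : ℂ}
    (hz : z ∈ ball 0 r) : HasSum (fun n => PowerSeries.coeff n (taylorSeries f) * z ^ n) (f z) := by
  convert! Complex.hasSum_taylorSeries_on_ball hf hz using 2 with n
  simp only [taylorSeries, PowerSeries.coeff_mk, smul_eq_mul, sub_zero]
  ring

theorem taylorSeries_eq_of_hasSum {f : ℂ → ℂ} {a : ℕ → ℂ}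
    (h : ∀ᶠ z in 𝓝 0, HasSum (fun n => a n * z ^ n) (f z)) :
    taylorSeries f = PowerSeries.mk a := by
  have h1 : HasFPowerSeriesAt f (FormalMultilinearSeries.ofScalars ℂ a) 0 := by
    rw [hasFPowerSeriesAt_iff]
    filter_upwards [h] with z hz
    simpa [FormalMultilinearSeries.coeff_ofScalars, mul_comm] using hz
  have h2 := h1.analyticAt.hasFPowerSeriesAt
  have h3 := h1.eq_formalMultilinearSeries h2
  ext n
  have h4 := congrArg (fun p => p.coeff n) h3
  simpa [taylorSeries, FormalMultilinearSeries.coeff_ofScalars] using h4.symm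

theorem norm_coeff_taylorSeries_le {f : ℂ → ℂ} {r s B : ℝ} (hs : 0 < s) (hsr : s < r)
    (hf : DifferentiableOn ℂ f (ball 0 r)) (hB : ∀ z ∈ sphere (0 : ℂ) s, ‖f z‖ ≤ B) (n : ℕ) :
    ‖PowerSeries.coeff n (taylorSeries f)‖ * s ^ n ≤ B := by
  have h := Complex.norm_iteratedDeriv_le_of_forall_mem_sphere_norm_le n hs
    ((hf.mono (closedBall_subset_ball hsr)).diffContOnCl_ball subset_rfl) hB
  have hn : (0 : ℝ) < n.factorial := by positivity
  rw [taylorSeries, PowerSeries.coeff_mk, norm_div, Complex.norm_natCast]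
  rw [mul_div_assoc] at h
  calc _ ≤ n.factorial * (B / s ^ n) / n.factorial * s ^ n := by gcongr
    _ = B := by field_simp

theorem constantCoeff_taylorSeries (f : ℂ → ℂ) :
    PowerSeries.constantCoeff (taylorSeries f) = f 0 := by
  rw [← PowerSeries.coeff_zero_eq_constantCoeff_apply]
  simp [taylorSeries]

/-- Power series over a field form a domain, so `p = ± q`, and the constant term fixes the sign.
This identifies analytic square roots with the generating series. -/
theorem powerSeries_eq_of_sq_eq {p q : PowerSeries ℂ} (h : p ^ 2 = q ^ 2)
    (hp : PowerSeries.constantCoeff p = 1) (hq : PowerSeries.constantCoeff q = 1) : p = q := by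
  rcases sq_eq_sq_iff_eq_or_eq_neg.mp h with h | h
  · exact h
  · have := congrArg PowerSeries.constantCoeff h
    rw [map_neg, hp, hq] at this
    norm_num at this

/-! ### Square roots of holomorphic functions on discs -/

theorem exists_sq_eq_of_ne_zero {F : ℂ → ℂ} {r : ℝ} (hF : DifferentiableOn ℂ F (ball 0 r))
    (h0 : F 0 = 1) (hne : ∀ z ∈ ball (0 : ℂ) r, F z ≠ 0) :
    ∃ K : ℂ → ℂ, DifferentiableOn ℂ K (ball 0 r) ∧ K 0 = 1 ∧ ∀ z ∈ ball (0 : ℂ) r, K z ^ 2 = F z := by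
  -- `L` is the primitive of `F'/F` vanishing at `0`, so `F e^{-L}` is constant and `e^{L/2}` is the
  -- root.
  obtain ⟨L, hL0, hL⟩ := (((hF.deriv isOpen_ball).div hF hne).isExactOn_ball).with_val_at 0 0
  have key : ∀ z ∈ ball (0 : ℂ) r, F z * Complex.exp (-L z) = 1 := by
    intro z hz
    have hd : ∀ w ∈ ball (0 : ℂ) r, HasDerivAt (fun w => F w * Complex.exp (-L w)) 0 w := by
      intro w hw
      have h1 := (hF.differentiableAt (isOpen_ball.mem_nhds hw)).hasDerivAt
      have h2 := (hL w hw).neg.cexp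
      refine (h1.mul h2).congr_deriv ?_
      have := hne w hw
      simp only [Pi.div_apply, Pi.neg_apply]
      field_simp
      ring
    have h0r : (0 : ℂ) ∈ ball (0 : ℂ) r := mem_ball_self (pos_of_mem_ball hz)
    have := isOpen_ball.is_const_of_deriv_eq_zero (convex_ball (0 : ℂ) r).isPreconnected
      (fun w hw => (hd w hw).differentiableAt.differentiableWithinAt)
      (fun w hw => (hd w hw).deriv) hz h0r
    simpa [h0, hL0] using this
  refine ⟨fun z => Complex.exp (L z / 2), ?_, by simp [hL0], fun z hz => ?_⟩
  · intro z hz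
    exact ((hL z hz).differentiableAt.div_const 2).cexp.differentiableWithinAt
  · rw [← Complex.exp_nat_mul, show ((2 : ℕ) : ℂ) * (L z / 2) = L z by push_cast; ring]
    have := key z hz
    rw [Complex.exp_neg] at this
    field_simp at this
    exact this.symm

/-- Dividing by `1 - z/a` leaves `-a * dslope F a`, which is `1` at `0`. It is zero-free: at `a` its
value is `-a F'(a)`, and elsewhere `F` has no zero. -/
theorem exists_sq_mul_eq_of_simple_zero {F : ℂ → ℂ} {r : ℝ} (hF : DifferentiableOn ℂ F (ball 0 r))
    (h0 : F 0 = 1) {a : ℂ} (ha : a ∈ ball (0 : ℂ) r) (hFa : F a = 0) (hFa' : deriv F a ≠ 0)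
    (huniq : ∀ z ∈ ball (0 : ℂ) r, F z = 0 → z = a) :
    ∃ K : ℂ → ℂ, DifferentiableOn ℂ K (ball 0 r) ∧ K 0 = 1 ∧ K a ≠ 0 ∧
      ∀ z ∈ ball (0 : ℂ) r, K z ^ 2 * (1 - z / a) = F z := by
  have ha0 : a ≠ 0 := by
    rintro rfl
    simp [h0] at hFa
  have hmul : ∀ z, -a * dslope F a z * (1 - z / a) = F z := by
    intro z
    have := sub_smul_dslope F a z
    rw [hFa, sub_zero, smul_eq_mul] at this
    rw [← this]
    field_simp
    ring
  have hne : ∀ z ∈ ball (0 : ℂ) r, -a * dslope F a z ≠ 0 := by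
    intro z hz h
    by_cases hza : z = a
    · rw [hza, dslope_same] at h
      simp_all
    · apply hza (huniq z hz _)
      rw [← hmul, h, zero_mul]
  obtain ⟨K, hK, hK0, hK2⟩ := exists_sq_eq_of_ne_zero (F := fun z => -a * dslope F a z)
    (((Complex.differentiableOn_dslope (isOpen_ball.mem_nhds ha)).mpr hF).const_mul (-a))
    (by simpa [h0] using hmul 0) hne
  refine ⟨K, hK, hK0, fun h => hne a ha ?_, fun z hz => ?_⟩
  · rw [← hK2 a ha, h]; simp
  · rw [hK2 z hz, hmul]

/-! ### The rescaled coefficients -/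

/-- The coefficients of the solution `g` of `g(u) ^ 2 = g(t u ^ 2) - u`, `g(0) = 1`. For `c ≠ 0`
one has `M_n(-c / 2) = c ^ n * scaledCoeff c⁻¹ n`. -/
noncomputable def scaledCoeff (t : ℂ) : ℕ → ℂ
  | 0 => 1
  | n + 1 =>
    (if Even (n + 1) then t ^ ((n + 1) / 2) * scaledCoeff t ((n + 1) / 2) else 0) / 2
      - (if n = 0 then 1 / 2 else 0)
      - 1 / 2 * ∑ i : Fin n, scaledCoeff t (i + 1) * scaledCoeff t (n - i)
decreasing_by all_goals omega

theorem scaledCoeff_zero (t : ℂ) : scaledCoeff t 0 = 1 := by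
  rw [scaledCoeff]

theorem scaledCoeff_one (t : ℂ) : scaledCoeff t 1 = -1 / 2 := by
  rw [scaledCoeff]
  norm_num

/-- Adding the two end terms turns the recursion into a full convolution: this is the coefficient
form of `g(u)^2 = g(t u^2) - u`. -/
theorem sum_antidiagonal_scaledCoeff (t : ℂ) (n : ℕ) :
    ∑ p ∈ Finset.HasAntidiagonal.antidiagonal n, scaledCoeff t p.1 * scaledCoeff t p.2 =
      (if Even n then t ^ (n / 2) * scaledCoeff t (n / 2) else 0) - if n = 1 then 1 else 0 := by
  cases n with
  | zero => simp [scaledCoeff_zero]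
  | succ n =>
    rw [Finset.Nat.sum_antidiagonal_eq_sum_range_succ_mk, Finset.sum_range_succ,
      Finset.sum_range_succ', Nat.sub_self, Nat.sub_zero, scaledCoeff_zero, one_mul, mul_one]
    have h := scaledCoeff.eq_2 t n
    rw [Fin.sum_univ_eq_sum_range (fun i => scaledCoeff t (i + 1) * scaledCoeff t (n - i))] at h
    have h2 : ∑ k ∈ Finset.range n, scaledCoeff t (k + 1) * scaledCoeff t (n + 1 - (k + 1)) =
        ∑ k ∈ Finset.range n, scaledCoeff t (k + 1) * scaledCoeff t (n - k) :=
      Finset.sum_congr rfl fun i _ => by rw [Nat.add_sub_add_right]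
    rw [h2, h]
    by_cases hn : n = 0
    · simp [hn]; ring
    · simp only [hn, Nat.add_eq_right, if_false]; ring

theorem continuous_scaledCoeff (n : ℕ) : Continuous fun t => scaledCoeff t n := by
  induction n using Nat.strong_induction_on with
  | _ n ih =>
    cases n with
    | zero => simp only [scaledCoeff_zero]; exact continuous_const
    | succ n =>
      have h : (fun t => scaledCoeff t (n + 1)) = _ := funext fun t => scaledCoeff.eq_2 t n
      rw [h]
      refine ((Continuous.div_const ?_ _).sub continuous_const).sub (continuous_const.mul ?_)
      · split_ifs
        · exact (continuous_id.pow _).mul (ih _ (by omega))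
        · exact continuous_const
      · exact continuous_finsetSum _ fun i _ => (ih _ (by omega)).mul (ih _ (by omega))

/-- The shift to `n + 1` matters: at index `0` one side would be the placeholder `0`, the other `1`.
-/
theorem aeval_mandelbrotPoly {c : ℂ} (hc : c ≠ 0) (n : ℕ) :
    aeval (-c / 2) (mandelbrotPoly (n + 1)) = c ^ (n + 1) * scaledCoeff c⁻¹ (n + 1) := by
  induction n using Nat.strong_induction_on with
  | _ n ih =>
    have ih' : ∀ m, 0 < m → m < n + 1 →
        aeval (-c / 2) (mandelbrotPoly m) = c ^ m * scaledCoeff c⁻¹ m := by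
      intro m hm hmn
      obtain ⟨k, rfl⟩ : ∃ k, m = k + 1 := ⟨m - 1, by omega⟩
      exact ih k (by omega)
    cases n with
    | zero =>
      rw [zero_add, mandelbrotPoly_one, scaledCoeff_one, aeval_X]
      ring
    | succ n =>
      rw [mandelbrotPoly, scaledCoeff]
      have hsum : ∑ i : Fin (n + 1), aeval (-c / 2) (mandelbrotPoly (i + 1) *
          mandelbrotPoly (n + 1 - i)) = c ^ (n + 2) * ∑ i : Fin (n + 1),
          scaledCoeff c⁻¹ (i + 1) * scaledCoeff c⁻¹ (n + 1 - i) := by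
        rw [Finset.mul_sum]
        refine Finset.sum_congr rfl fun i _ => ?_
        rw [map_mul, ih' _ (by omega) (by omega), ih' _ (by omega) (by omega),
          show n + 2 = (i + 1) + (n + 1 - i) by omega, pow_add c (i + 1)]
        ring
      have heven : aeval (-c / 2) (if Even (n + 2) then
          Polynomial.C (1 / 2 : ℚ) * mandelbrotPoly ((n + 2) / 2) else 0) =
          c ^ (n + 2) * ((if Even (n + 2) then c⁻¹ ^ ((n + 2) / 2) *
            scaledCoeff c⁻¹ ((n + 2) / 2) else 0) / 2) := by
        split_ifs with h
        · rw [map_mul, ih' _ (by omega) (by omega), aeval_C]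
          obtain ⟨k, hk⟩ := h
          rw [show (n + 2) / 2 = k by omega, hk, pow_add, inv_pow]
          simp
          field_simp
        · simp
      rw [map_sub, map_mul, map_sum, hsum, heven, aeval_C, if_neg (Nat.succ_ne_zero n), sub_zero,
        eq_ratCast]
      push_cast
      ring

theorem catalan_mono : Monotone catalan := by
  refine monotone_nat_of_le_succ fun n => ?_
  rw [catalan_succ']
  have := Finset.single_le_sum (f := fun ij : ℕ × ℕ => catalan ij.1 * catalan ij.2)
    (fun _ _ => Nat.zero_le _)
    (Finset.HasAntidiagonal.mem_antidiagonal.mpr (show (n, 0).1 + (n, 0).2 = n from add_zero n))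
  simpa using this

/-- The convolution is majorised by the Catalan recursion. The even term obeys the same bound, so
the two factors `1/2` add up to `1`. The bound depends on `t` only through `D`, hence is locally
uniform. -/
theorem norm_scaledCoeff_succ_le {t : ℂ} {D : ℝ} (hD : 1 ≤ D) (ht : ‖t‖ ≤ D) (n : ℕ) :
    ‖scaledCoeff t (n + 1)‖ ≤ catalan n * D ^ (n + 1) := by
  induction n using Nat.strong_induction_on with
  | _ n ih =>
    have ih' : ∀ m, 0 < m → m < n + 1 → ‖scaledCoeff t m‖ ≤ catalan (m - 1) * D ^ m := by
      intro m hm hmn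
      obtain ⟨k, rfl⟩ : ∃ k, m = k + 1 := ⟨m - 1, by omega⟩
      exact ih k (by omega)
    cases n with
    | zero =>
      rw [zero_add, scaledCoeff_one]
      norm_num
      linarith
    | succ n =>
      rw [scaledCoeff, if_neg (Nat.succ_ne_zero n), sub_zero]
      have hsum : ‖∑ i : Fin (n + 1), scaledCoeff t (i + 1) * scaledCoeff t (n + 1 - i)‖ ≤
          catalan (n + 1) * D ^ (n + 2) := by
        rw [catalan_succ]
        push_cast
        rw [Finset.sum_mul]
        refine norm_sum_le_of_le _ fun i _ => ?_
        rw [norm_mul, show n + 2 = (i + 1) + (n + 1 - i) by omega, pow_add D (i + 1)]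
        have h1 := ih' (i + 1) (by omega) (by omega)
        have h2 := ih' (n + 1 - i) (by omega) (by omega)
        rw [Nat.add_sub_cancel] at h1
        rw [show n + 1 - i - 1 = n - i by omega] at h2
        calc _ ≤ (catalan i * D ^ ((i : ℕ) + 1)) * (catalan (n - i) * D ^ (n + 1 - (i : ℕ))) := by
              gcongr
          _ = _ := by ring
      have heven : ‖if Even (n + 1 + 1) then t ^ ((n + 1 + 1) / 2) *
            scaledCoeff t ((n + 1 + 1) / 2) else 0‖ ≤ catalan (n + 1) * D ^ (n + 2) := by
        split_ifs with h
        · obtain ⟨k, hk⟩ := h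
          have h1 := ih' k (by omega) (by omega)
          have h3 : (catalan (k - 1) : ℝ) ≤ catalan (n + 1) := by
            exact_mod_cast catalan_mono (by omega)
          rw [show (n + 1 + 1) / 2 = k by omega, show n + 2 = k + k by omega, pow_add, norm_mul,
            norm_pow]
          calc _ ≤ D ^ k * (catalan (n + 1) * D ^ k) := by
                gcongr
                exact h1.trans (by gcongr)
            _ = _ := by ring
        · rw [norm_zero]; positivity
      refine (norm_sub_le _ _).trans ?_
      rw [norm_div, norm_mul]
      norm_num
      linarith

theorem norm_scaledCoeff_le {t : ℂ} {D : ℝ} (hD : 1 ≤ D) (ht : ‖t‖ ≤ D) (n : ℕ) :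
    ‖scaledCoeff t n‖ ≤ (4 * D) ^ n := by
  cases n with
  | zero => simp [scaledCoeff_zero]
  | succ n =>
    refine (norm_scaledCoeff_succ_le hD ht n).trans ?_
    rw [mul_pow]
    gcongr
    have h : catalan n ≤ 4 ^ n := by
      rw [catalan_eq_centralBinom_div]
      exact (Nat.div_le_self _ _).trans (Nat.centralBinom_le_four_pow n)
    calc (catalan n : ℝ) ≤ 4 ^ n := by exact_mod_cast h
      _ ≤ 4 ^ (n + 1) := pow_le_pow_right₀ (by norm_num) (Nat.le_succ n)

/-! ### The generating function -/

/-- The generating function of `scaledCoeff t`. -/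
noncomputable def gen (t u : ℂ) : ℂ := ∑' n, scaledCoeff t n * u ^ n

theorem gen_zero_right (t : ℂ) : gen t 0 = 1 := by
  rw [gen, tsum_eq_single 0 fun n hn => by simp [hn]]
  simp [scaledCoeff_zero]

section Gen

variable {t : ℂ} {s B : ℝ}

theorem norm_scaledCoeff_mul_pow_le (hs : 0 < s) (h : ∀ n, ‖scaledCoeff t n‖ * s ^ n ≤ B) (u : ℂ)
    (n : ℕ) : ‖scaledCoeff t n * u ^ n‖ ≤ B * (‖u‖ / s) ^ n := by
  rw [norm_mul, norm_pow, div_pow]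
  calc _ = ‖scaledCoeff t n‖ * s ^ n * (‖u‖ ^ n / s ^ n) := by field_simp
    _ ≤ _ := by gcongr; exact h n

theorem summable_norm_gen (hs : 0 < s) (h : ∀ n, ‖scaledCoeff t n‖ * s ^ n ≤ B) {u : ℂ}
    (hu : ‖u‖ < s) : Summable fun n => ‖scaledCoeff t n * u ^ n‖ :=
  .of_nonneg_of_le (fun _ => norm_nonneg _) (norm_scaledCoeff_mul_pow_le hs h u)
    ((summable_geometric_of_lt_one (by positivity) ((div_lt_one hs).mpr hu)).mul_left B)

theorem hasSum_gen (hs : 0 < s) (h : ∀ n, ‖scaledCoeff t n‖ * s ^ n ≤ B) {u : ℂ}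
    (hu : ‖u‖ < s) : HasSum (fun n => scaledCoeff t n * u ^ n) (gen t u) :=
  (summable_norm_gen hs h hu).of_norm.hasSum

theorem differentiableOn_gen (hs : 0 < s) (h : ∀ n, ‖scaledCoeff t n‖ * s ^ n ≤ B) :
    DifferentiableOn ℂ (gen t) (ball 0 s) := by
  intro u hu
  rw [mem_ball_zero_iff] at hu
  obtain ⟨r, hur, hrs⟩ := exists_between hu
  have hr : 0 ≤ r := (norm_nonneg u).trans hur.le
  have : DifferentiableOn ℂ (gen t) (ball 0 r) := by
    refine Complex.differentiableOn_tsum_of_summable_norm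
      ((summable_geometric_of_lt_one (by positivity) ((div_lt_one hs).mpr hrs)).mul_left B)
      (fun n => by fun_prop) isOpen_ball fun n w hw => ?_
    refine (norm_scaledCoeff_mul_pow_le hs h w n).trans ?_
    have hB : 0 ≤ B := le_trans (by positivity) (h 0)
    have := (mem_ball_zero_iff.mp hw).le
    gcongr
  exact (this.differentiableAt (isOpen_ball.mem_nhds (mem_ball_zero_iff.mpr hur))).differentiableWithinAt

theorem gen_sq (hs : 0 < s) (h : ∀ n, ‖scaledCoeff t n‖ * s ^ n ≤ B) {u : ℂ}
    (hu : ‖u‖ < s) (hu' : ‖t * u ^ 2‖ < s) : gen t u ^ 2 = gen t (t * u ^ 2) - u := by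
  have h1 := summable_norm_gen hs h hu
  have h2 : HasSum (fun n => if Even n then t ^ (n / 2) * scaledCoeff t (n / 2) * u ^ n else 0)
      (gen t (t * u ^ 2)) := by
    refine (Function.Injective.hasSum_iff (g := fun n : ℕ => 2 * n)
      (fun a b hab => by simpa using hab) fun n hn => ?_).mp ?_
    · rw [if_neg]
      exact fun ⟨k, hk⟩ => hn ⟨k, by simp only; omega⟩
    · refine HasSum.congr_fun (hasSum_gen hs h hu') ?_
      intro n
      simp [pow_mul, mul_pow]
      ring
  have h3 : HasSum (fun n => if n = 1 then u else 0) u := hasSum_ite_eq 1 u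
  rw [sq, gen, tsum_mul_tsum_eq_tsum_sum_antidiagonal_of_summable_norm h1 h1,
    ← (h2.sub h3).tsum_eq]
  refine tsum_congr fun n => ?_
  have h4 := sum_antidiagonal_scaledCoeff t n
  calc _ = (∑ p ∈ Finset.HasAntidiagonal.antidiagonal n, scaledCoeff t p.1 * scaledCoeff t p.2) * u ^ n := by
        rw [Finset.sum_mul]
        refine Finset.sum_congr rfl fun p hp => ?_
        rw [← Finset.HasAntidiagonal.mem_antidiagonal.mp hp, pow_add]
        ring
    _ = _ := by
        rw [h4]
        split_ifs with h5 h6 h6 <;> simp_all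

theorem taylorSeries_gen (hs : 0 < s) (h : ∀ n, ‖scaledCoeff t n‖ * s ^ n ≤ B) :
    taylorSeries (gen t) = PowerSeries.mk (scaledCoeff t) :=
  taylorSeries_eq_of_hasSum <| by
    filter_upwards [ball_mem_nhds (0 : ℂ) hs] with u hu
    exact hasSum_gen hs h (mem_ball_zero_iff.mp hu)

end Gen

/-! ### The functional equation `A(t y ^ 2) = A(y) ^ 2 + t y ^ 2`

The function `y ↦ A(y) / (t y)` is the inverse of the Böttcher coordinate of `z ↦ z ^ 2 + t⁻¹`
at infinity, in the coordinate `t y = 1 / w`. -/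

section Conjugacy

variable {t : ℂ} {r : ℝ} {A : ℂ → ℂ}

theorem norm_mul_sq_lt (htr : ‖t‖ * r ≤ 1) {y : ℂ} (hy : y ∈ ball (0 : ℂ) r) (hy0 : y ≠ 0) :
    ‖t * y ^ 2‖ < ‖y‖ := by
  rw [mem_ball_zero_iff] at hy
  have h0 : 0 < ‖y‖ := norm_pos_iff.mpr hy0
  have h1 : ‖t‖ * ‖y‖ < 1 := by
    rcases (norm_nonneg t).eq_or_lt with h | h
    · rw [← h]; simp
    · nlinarith
  rw [norm_mul, norm_pow]
  nlinarith

theorem mul_sq_mem_ball (htr : ‖t‖ * r ≤ 1) {y : ℂ} (hy : y ∈ ball (0 : ℂ) r) :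
    t * y ^ 2 ∈ ball (0 : ℂ) r := by
  by_cases hy0 : y = 0
  · simpa [hy0] using hy
  · rw [mem_ball_zero_iff] at hy ⊢
    exact (norm_mul_sq_lt htr (mem_ball_zero_iff.mpr hy) hy0).trans hy

theorem iterate_mul_sq_mem_ball (htr : ‖t‖ * r ≤ 1) {y : ℂ} (hy : y ∈ ball (0 : ℂ) r) (n : ℕ) :
    (fun y => t * y ^ 2)^[n] y ∈ ball (0 : ℂ) r := by
  induction n with
  | zero => exact hy
  | succ n ih => rw [Function.iterate_succ_apply']; exact mul_sq_mem_ball htr ih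

theorem iterate_mul_sq_ne_zero (ht : t ≠ 0) {y : ℂ} (hy : y ≠ 0) (n : ℕ) :
    (fun y => t * y ^ 2)^[n] y ≠ 0 := by
  induction n with
  | zero => exact hy
  | succ n ih =>
    rw [Function.iterate_succ_apply']
    exact mul_ne_zero ht (pow_ne_zero 2 ih)

theorem norm_iterate_mul_sq_lt (ht : t ≠ 0) {v y : ℂ} (h : ‖v‖ < ‖y‖) (n : ℕ) :
    ‖(fun y => t * y ^ 2)^[n] v‖ < ‖(fun y => t * y ^ 2)^[n] y‖ := by
  induction n with
  | zero => exact h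
  | succ n ih =>
    simp only [Function.iterate_succ_apply', norm_mul, norm_pow]
    have := norm_pos_iff.mpr ht
    gcongr

theorem norm_iterate_succ_mul_sq_lt (ht : t ≠ 0) (htr : ‖t‖ * r ≤ 1) {y : ℂ}
    (hy : y ∈ ball (0 : ℂ) r) (hy0 : y ≠ 0) (n : ℕ) :
    ‖(fun y => t * y ^ 2)^[n + 1] y‖ < ‖y‖ := by
  induction n with
  | zero => exact norm_mul_sq_lt htr hy hy0
  | succ n ih =>
    rw [Function.iterate_succ_apply']
    exact (norm_mul_sq_lt htr (iterate_mul_sq_mem_ball htr hy _)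
      (iterate_mul_sq_ne_zero ht hy0 _)).trans ih

theorem tendsto_iterate_mul_sq (htr : ‖t‖ * r ≤ 1) {y : ℂ} (hy : y ∈ ball (0 : ℂ) r) :
    Tendsto (fun n => (fun y => t * y ^ 2)^[n] y) atTop (𝓝 0) := by
  have hyr := mem_ball_zero_iff.mp hy
  set q := ‖t‖ * ‖y‖ with hq
  have hq0 : 0 ≤ q := by positivity
  have hq1 : q < 1 := by
    rcases (norm_nonneg t).eq_or_lt with h | h
    · rw [hq, ← h]; simp
    · nlinarith
  have hle : ∀ n, ‖(fun y => t * y ^ 2)^[n] y‖ ≤ ‖y‖ * q ^ n := by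
    intro n
    induction n with
    | zero => simp
    | succ n ih =>
      rw [Function.iterate_succ_apply', norm_mul, norm_pow]
      have h1 : ‖(fun y => t * y ^ 2)^[n] y‖ ≤ ‖y‖ :=
        ih.trans (mul_le_of_le_one_right (norm_nonneg _) (pow_le_one₀ hq0 hq1.le))
      calc _ ≤ ‖t‖ * (‖y‖ * (‖y‖ * q ^ n)) := by rw [sq]; gcongr
        _ = _ := by rw [pow_succ, hq]; ring
  refine squeeze_zero_norm hle ?_
  simpa using (tendsto_pow_atTop_nhds_zero_of_lt_one hq0 hq1).const_mul ‖y‖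

theorem hasStrictDerivAt_id_div (hr : 0 < r) (hA : DifferentiableOn ℂ A (ball 0 r))
    (h0 : A 0 = 1) : HasStrictDerivAt (fun y => y / A y) 1 0 := by
  have h1 : HasStrictDerivAt A (deriv A 0) 0 :=
    (hA.analyticAt (ball_mem_nhds 0 hr)).hasStrictDerivAt
  refine ((hasStrictDerivAt_id (0 : ℂ)).div h1 (by rw [h0]; exact one_ne_zero)).congr_deriv ?_
  simp [h0]

/-- The hypothesis is `ψ(y) = ψ(z)`, cross-multiplied so as to make sense at zeros of `A`. It
persists along the orbits of `y ↦ t y^2`, which tend to `0`, where `y / A y` is injective; so the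
orbits merge. -/
theorem exists_iterate_eq (hr : 0 < r) (htr : ‖t‖ * r ≤ 1)
    (hA : DifferentiableOn ℂ A (ball 0 r)) (h0 : A 0 = 1)
    (hfe : ∀ y ∈ ball (0 : ℂ) r, A (t * y ^ 2) = A y ^ 2 + t * y ^ 2)
    {y z : ℂ} (hy : y ∈ ball (0 : ℂ) r) (hz : z ∈ ball (0 : ℂ) r) (h : y * A z = z * A y) :
    ∃ n, (fun y => t * y ^ 2)^[n] y = (fun y => t * y ^ 2)^[n] z ∧
      ∀ m, (fun y => t * y ^ 2)^[m] y * A ((fun y => t * y ^ 2)^[m] z) =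
        (fun y => t * y ^ 2)^[m] z * A ((fun y => t * y ^ 2)^[m] y) := by
  have hrel : ∀ m, (fun y => t * y ^ 2)^[m] y * A ((fun y => t * y ^ 2)^[m] z) =
        (fun y => t * y ^ 2)^[m] z * A ((fun y => t * y ^ 2)^[m] y) := by
    intro m
    induction m with
    | zero => exact h
    | succ m ih =>
      simp only [Function.iterate_succ_apply']
      rw [hfe _ (iterate_mul_sq_mem_ball htr hy m), hfe _ (iterate_mul_sq_mem_ball htr hz m)]
      set p := (fun y => t * y ^ 2)^[m] y
      set q := (fun y => t * y ^ 2)^[m] z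
      linear_combination t * (p * A q + q * A p) * ih
  have hQ := hasStrictDerivAt_id_div hr hA h0
  have hne : ∀ᶠ y in 𝓝 (0 : ℂ), A y ≠ 0 :=
    (hA.continuousOn.continuousAt (ball_mem_nhds 0 hr)).eventually_ne (by rw [h0]; exact one_ne_zero)
  have hinv := hQ.eventually_left_inverse one_ne_zero
  have hev := hne.and hinv
  obtain ⟨n, ⟨hn1, hn2⟩, hn3, hn4⟩ := ((tendsto_iterate_mul_sq htr hy).eventually hev |>.and
    ((tendsto_iterate_mul_sq htr hz).eventually hev)).exists
  refine ⟨n, ?_, hrel⟩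
  rw [← hn2, ← hn4]
  congr 1
  rw [div_eq_div_iff hn1 hn3]
  exact hrel n

/-- Just before two distinct orbits merge they sit at `p` and `-p`. Evenness of `A` then forces `A p
= 0`, so `v = t p^2` is again a fixed point of `A`. It lies on the orbit of `y` with `|v| < |y|`, so
the orbits of `v` and `y` never meet, contradicting `exists_iterate_eq`. -/
theorem eq_of_isFixedPt (ht : t ≠ 0) (hr : 0 < r) (htr : ‖t‖ * r ≤ 1)
    (hA : DifferentiableOn ℂ A (ball 0 r)) (h0 : A 0 = 1) (heven : ∀ y, A (-y) = A y)
    (hfe : ∀ y ∈ ball (0 : ℂ) r, A (t * y ^ 2) = A y ^ 2 + t * y ^ 2)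
    {y z : ℂ} (hy : y ∈ ball (0 : ℂ) r) (hz : z ∈ ball (0 : ℂ) r) (hAy : A y = y) (hAz : A z = z) :
    y = z := by
  classical
  have hy0 : y ≠ 0 := by
    rintro rfl
    rw [h0] at hAy
    exact one_ne_zero hAy
  have hex := exists_iterate_eq hr htr hA h0 hfe hy hz (by rw [hAy, hAz, mul_comm])
  obtain ⟨h1, h2⟩ := Nat.find_spec hex
  cases hn : Nat.find hex with
  | zero => rw [hn] at h1; exact h1
  | succ k =>
    rw [hn] at h1
    have hk : (fun y => t * y ^ 2)^[k] y ≠ (fun y => t * y ^ 2)^[k] z := fun h =>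
      Nat.find_min hex (by omega : k < Nat.find hex) ⟨h, h2⟩
    have h3 := h2 k
    have hp0 := iterate_mul_sq_ne_zero ht hy0 k
    have hpr := iterate_mul_sq_mem_ball htr hy k
    simp only [Function.iterate_succ_apply'] at h1
    have h5 := mul_left_cancel₀ ht h1
    rcases sq_eq_sq_iff_eq_or_eq_neg.mp h5.symm with h6 | h6
    · exact absurd h6.symm hk
    rw [h6, heven] at h3
    have hAp : A ((fun y => t * y ^ 2)^[k] y) = 0 := by
      have : 2 * (fun y => t * y ^ 2)^[k] y * A ((fun y => t * y ^ 2)^[k] y) = 0 := by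
        linear_combination h3
      simpa [hp0] using this
    have hv := hfe _ hpr
    rw [hAp, zero_pow two_ne_zero, zero_add] at hv
    have hlt := norm_iterate_succ_mul_sq_lt ht htr hy hy0 k
    rw [Function.iterate_succ_apply'] at hlt
    obtain ⟨m, hm, -⟩ := exists_iterate_eq hr htr hA h0 hfe hy (mul_sq_mem_ball htr hpr)
      (by rw [hAy, hv, mul_comm])
    have := norm_iterate_mul_sq_lt ht hlt m
    rw [← hm] at this
    exact absurd this (lt_irrefl _)

/-- `W = A - y A'`, the numerator of `(y / A)'`, satisfies `W(t y^2) = A(y) W(y)`. A zero of `W` at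
`y` would propagate along the orbit to `0`, where `W = 1`. -/
theorem deriv_ne_one_of_isFixedPt (hr : 0 < r) (htr : ‖t‖ * r ≤ 1)
    (hA : DifferentiableOn ℂ A (ball 0 r)) (h0 : A 0 = 1)
    (hfe : ∀ y ∈ ball (0 : ℂ) r, A (t * y ^ 2) = A y ^ 2 + t * y ^ 2)
    {y : ℂ} (hy : y ∈ ball (0 : ℂ) r) (hAy : A y = y) : deriv A y ≠ 1 := by
  intro hd
  have hW : ∀ y ∈ ball (0 : ℂ) r, A (t * y ^ 2) - t * y ^ 2 * deriv A (t * y ^ 2) =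
      A y * (A y - y * deriv A y) := by
    intro y hy
    have hAd : ∀ y ∈ ball (0 : ℂ) r, HasDerivAt A (deriv A y) y := fun y hy =>
      (hA.differentiableAt (isOpen_ball.mem_nhds hy)).hasDerivAt
    have hE : HasDerivAt (fun y : ℂ => t * y ^ 2) (t * (2 * y)) y := by
      simpa using (hasDerivAt_pow 2 y).const_mul t
    have h1 : HasDerivAt (fun y => A (t * y ^ 2)) (deriv A (t * y ^ 2) * (t * (2 * y))) y :=
      (hAd _ (mul_sq_mem_ball htr hy)).comp y hE
    have h2 : HasDerivAt (fun y => A y ^ 2 + t * y ^ 2)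
        (2 * A y * deriv A y + t * (2 * y)) y := by
      refine (((hAd y hy).pow 2).add hE).congr_deriv ?_
      simp
    have h3 : (fun y => A (t * y ^ 2)) =ᶠ[𝓝 y] fun y => A y ^ 2 + t * y ^ 2 :=
      Filter.eventually_of_mem (isOpen_ball.mem_nhds hy) hfe
    have h4 := h1.unique (h2.congr_of_eventuallyEq h3)
    linear_combination hfe y hy - y / 2 * h4
  have hzero : ∀ n, A ((fun y => t * y ^ 2)^[n] y) -
      (fun y => t * y ^ 2)^[n] y * deriv A ((fun y => t * y ^ 2)^[n] y) = 0 := by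
    intro n
    induction n with
    | zero => simp [hAy, hd]
    | succ n ih =>
      rw [Function.iterate_succ_apply', hW _ (iterate_mul_sq_mem_ball htr hy n), ih, mul_zero]
  have hc : ContinuousAt (fun y => A y - y * deriv A y) 0 :=
    (hA.continuousOn.continuousAt (ball_mem_nhds 0 hr)).sub
      (continuousAt_id.mul ((hA.deriv isOpen_ball).continuousOn.continuousAt (ball_mem_nhds 0 hr)))
  have := hc.tendsto.comp (tendsto_iterate_mul_sq htr hy)
  have h1 := tendsto_nhds_unique (this.congr hzero) tendsto_const_nhds
  simp [h0] at h1

theorem exists_isFixedPt_of_notMem_mandelbrotSet {c : ℂ} (hc0 : c ≠ 0) (hc : c ∉ mandelbrotSet)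
    (hA : DifferentiableOn ℂ A (ball 0 ‖c‖)) (h0 : A 0 = 1) (heven : ∀ y, A (-y) = A y)
    (hfe : ∀ y ∈ ball (0 : ℂ) ‖c‖, A (c⁻¹ * y ^ 2) = A y ^ 2 + c⁻¹ * y ^ 2) :
    ∃ y ∈ ball (0 : ℂ) ‖c‖, A y = y := by
  have hr : 0 < ‖c‖ := norm_pos_iff.mpr hc0
  -- If `ψ` attains the `n`-th image of `ζ`, it attains `ζ`: each step back takes a square root of
  -- `c * v`, and evenness of `A` absorbs the sign.
  have descent : ∀ n : ℕ, ∀ ζ : ℂ,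
      (∃ v ∈ ball (0 : ℂ) ‖c‖, (fun z : ℂ => z ^ 2 + c)^[n] ζ * c⁻¹ * v = A v) →
      ∃ y ∈ ball (0 : ℂ) ‖c‖, ζ * c⁻¹ * y = A y := by
    intro n
    induction n with
    | zero => exact fun ζ h => h
    | succ n ih =>
      intro ζ h
      obtain ⟨v, hv, hvA⟩ := ih (ζ ^ 2 + c) h
      obtain ⟨y, hy⟩ := IsAlgClosed.exists_pow_nat_eq (c * v) two_pos
      have hv2 : c⁻¹ * y ^ 2 = v := by rw [hy]; field_simp
      have hyr : y ∈ ball (0 : ℂ) ‖c‖ := by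
        rw [mem_ball_zero_iff] at hv ⊢
        have : ‖y‖ ^ 2 < ‖c‖ ^ 2 := by
          rw [← norm_pow, hy, norm_mul, sq]
          gcongr
        exact lt_of_pow_lt_pow_left₀ 2 hr.le this
      have h1 := hfe y hyr
      rw [hv2, ← hvA, ← hv2] at h1
      have h2 : (ζ * c⁻¹ * y) ^ 2 = A y ^ 2 := by
        have : c * c⁻¹ = 1 := mul_inv_cancel₀ hc0
        linear_combination h1 - c⁻¹ * y ^ 2 * this
      rcases sq_eq_sq_iff_eq_or_eq_neg.mp h2 with h3 | h3
      · exact ⟨y, hyr, h3⟩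
      · exact ⟨-y, by simpa using hyr, by rw [heven]; linear_combination -h3⟩
  -- `y / A y` covers a disc of radius `ε` about `0`, so `ψ` attains every value of modulus above
  -- `‖c‖ / ε`; the critical orbit has such a point.
  have hQ := (hasStrictDerivAt_id_div hr hA h0).map_nhds_eq one_ne_zero
  have himg : (fun y => y / A y) '' ball (0 : ℂ) ‖c‖ ∈ 𝓝 (0 : ℂ) := by
    have := image_mem_map (m := fun y => y / A y) (ball_mem_nhds (0 : ℂ) hr)
    rw [hQ] at this
    simpa using this
  obtain ⟨ε, hε, hball⟩ := Metric.mem_nhds_iff.mp himg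
  have hunb : ∃ n, ‖c‖ / ε < ‖(fun z : ℂ => z ^ 2 + c)^[n] 0‖ := by
    by_contra! hle
    refine hc ?_
    rw [mandelbrotSet, Set.mem_ofPred_eq, isBounded_iff_forall_norm_le]
    refine ⟨‖c‖ / ε, ?_⟩
    rintro _ ⟨n, rfl⟩
    exact hle n
  obtain ⟨n, hn⟩ := hunb
  cases n with
  | zero =>
    rw [Function.iterate_zero_apply, norm_zero] at hn
    exact absurd hn (not_lt.mpr (by positivity))
  | succ n =>
    rw [Function.iterate_succ_apply, zero_pow two_ne_zero, zero_add] at hn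
    set ζ := (fun z : ℂ => z ^ 2 + c)^[n] c with hζ
    have hζ0 : ζ ≠ 0 := norm_pos_iff.mp (lt_of_le_of_lt (by positivity) hn)
    have hmem : c / ζ ∈ ball (0 : ℂ) ε := by
      rw [mem_ball_zero_iff, norm_div]
      rw [div_lt_iff₀ hε] at hn
      rw [div_lt_iff₀ (norm_pos_iff.mpr hζ0)]
      linarith
    obtain ⟨v, hv, hvA⟩ := hball hmem
    have hA0 : A v ≠ 0 := by
      intro h
      simp only [h, div_zero] at hvA
      exact div_ne_zero hc0 hζ0 hvA.symm
    obtain ⟨y, hy, hyA⟩ := descent n c ⟨v, hv, by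
      rw [← hζ]
      simp only at hvA
      field_simp at hvA ⊢
      linear_combination hvA⟩
    exact ⟨y, hy, by rw [← hyA, mul_inv_cancel₀ hc0, one_mul]⟩

end Conjugacy

/-! ### The power series of `√(1 - u)` -/

theorem mk_scaledCoeff_zero_sq :
    PowerSeries.mk (scaledCoeff 0) ^ 2 = 1 - PowerSeries.X := by
  ext n
  rw [sq, PowerSeries.coeff_mul]
  simp only [PowerSeries.coeff_mk]
  rw [sum_antidiagonal_scaledCoeff, map_sub, PowerSeries.coeff_one, PowerSeries.coeff_X]
  congr 1
  by_cases hn : n = 0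
  · simp [hn, scaledCoeff_zero]
  · rw [if_neg hn]
    split_ifs with h
    · rw [zero_pow (by obtain ⟨k, hk⟩ := h; omega), zero_mul]
    · rfl

/-- Coefficients of the differential equation `2 (1 - X) S' = -S`, obtained from `S^2 = 1 - X`. -/
theorem succ_mul_scaledCoeff_zero_succ (n : ℕ) :
    ((n : ℂ) + 1) * scaledCoeff 0 (n + 1) = (n - 1 / 2) * scaledCoeff 0 n := by
  have hS := mk_scaledCoeff_zero_sq
  set S := PowerSeries.mk (scaledCoeff 0) with hSdef
  have h1 := congrArg (PowerSeries.derivative ℂ) hS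
  rw [PowerSeries.derivative_pow, map_sub, PowerSeries.derivative_one,
    PowerSeries.derivative_X] at h1
  norm_num at h1
  have h2 : PowerSeries.derivative ℂ S + PowerSeries.derivative ℂ S - PowerSeries.X *
      (PowerSeries.derivative ℂ S + PowerSeries.derivative ℂ S) = - S := by
    linear_combination S * h1 - 2 * PowerSeries.derivative ℂ S * hS
  have h4 := congrArg (PowerSeries.coeff n) h2
  cases n with
  | zero =>
    simp only [map_sub, map_add, PowerSeries.coeff_zero_X_mul, PowerSeries.coeff_derivative, map_neg,
      hSdef, PowerSeries.coeff_mk] at h4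
    push_cast at h4 ⊢
    linear_combination h4 / 2
  | succ n =>
    simp only [map_sub, map_add, PowerSeries.coeff_succ_X_mul, PowerSeries.coeff_derivative, map_neg,
      hSdef, PowerSeries.coeff_mk] at h4
    push_cast at h4 ⊢
    linear_combination h4 / 2

theorem scaledCoeff_zero_ne_zero (n : ℕ) : scaledCoeff 0 n ≠ 0 := by
  induction n with
  | zero => simp [scaledCoeff_zero]
  | succ n ih =>
    intro h
    have h1 := succ_mul_scaledCoeff_zero_succ n
    rw [h, mul_zero] at h1
    rcases mul_eq_zero.mp h1.symm with h2 | h2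
    · have h3 : ((2 * n : ℕ) : ℂ) = (1 : ℕ) := by push_cast; linear_combination 2 * h2
      have := Nat.cast_injective h3
      omega
    · exact ih h2

theorem sq_mul_norm_scaledCoeff_zero_le (n : ℕ) :
    (n : ℝ) ^ 2 * ‖scaledCoeff 0 n‖ ≤ ((n : ℝ) + 1) ^ 2 * ‖scaledCoeff 0 (n + 1)‖ := by
  cases n with
  | zero => simp
  | succ n =>
    have h1 := congrArg norm (succ_mul_scaledCoeff_zero_succ (n + 1))
    have h2 : ‖((n + 1 : ℕ) : ℂ) + 1‖ = (n : ℝ) + 2 := by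
      rw [show ((n + 1 : ℕ) : ℂ) + 1 = ((n + 2 : ℕ) : ℂ) by push_cast; ring, Complex.norm_natCast]
      push_cast
      ring
    have h3 : ‖((n + 1 : ℕ) : ℂ) - 1 / 2‖ = (n : ℝ) + 1 / 2 := by
      rw [show ((n + 1 : ℕ) : ℂ) - 1 / 2 = (((n : ℝ) + 1 / 2 : ℝ) : ℂ) by push_cast; ring,
        Complex.norm_real, Real.norm_of_nonneg (by positivity)]
    rw [norm_mul, norm_mul, h2, h3] at h1
    have h4 : (0 : ℝ) ≤ ‖scaledCoeff 0 (n + 1)‖ := norm_nonneg _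
    push_cast
    have hn : (0 : ℝ) ≤ n := n.cast_nonneg
    calc _ ≤ ((n : ℝ) + 2) * (((n : ℝ) + 1 / 2) * ‖scaledCoeff 0 (n + 1)‖) := by
          rw [← mul_assoc]
          gcongr
          nlinarith
      _ = _ := by rw [← h1]; ring

theorem monotone_sq_mul_norm_scaledCoeff_zero :
    Monotone fun n : ℕ => (n : ℝ) ^ 2 * ‖scaledCoeff 0 n‖ :=
  monotone_nat_of_le_succ fun n => by
    simpa using sq_mul_norm_scaledCoeff_zero_le n

/-- A bound polynomial in `m` and uniform in `n`, which a geometric factor `q ^ m` makes summable.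
-/
theorem norm_scaledCoeff_zero_sub_le {m n : ℕ} (h : m ≤ n) :
    ‖scaledCoeff 0 (n - m)‖ ≤ 2 * ((m : ℝ) + 1) ^ 2 * ‖scaledCoeff 0 n‖ := by
  obtain ⟨j, rfl⟩ := Nat.exists_eq_add_of_le h
  rw [Nat.add_sub_cancel_left]
  have hpos : 0 ≤ ‖scaledCoeff 0 (m + j)‖ := norm_nonneg _
  -- For `j = 0` and `m > 0` the comparison is with index `1`, where the norm is `1/2`; this costs
  -- the factor `2`.
  rcases Nat.eq_zero_or_pos j with rfl | hj
  · rw [add_zero, scaledCoeff_zero, norm_one]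
    rcases Nat.eq_zero_or_pos m with rfl | hm
    · simp [scaledCoeff_zero]
    · have := monotone_sq_mul_norm_scaledCoeff_zero hm
      simp [scaledCoeff_one] at this
      have : (m : ℝ) ^ 2 * ‖scaledCoeff 0 m‖ ≤ ((m : ℝ) + 1) ^ 2 * ‖scaledCoeff 0 m‖ := by
        gcongr
        linarith
      linarith
  · have h1 := monotone_sq_mul_norm_scaledCoeff_zero (Nat.le_add_left j m)
    simp only at h1
    have hj' : (1 : ℝ) ≤ j := by exact_mod_cast hj
    have h2 : ((m + j : ℕ) : ℝ) ≤ (m + 1) * j := by push_cast; nlinarith [m.cast_nonneg (α := ℝ)]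
    have h3 : (j : ℝ) ^ 2 * ‖scaledCoeff 0 j‖ ≤
        (j : ℝ) ^ 2 * (((m : ℝ) + 1) ^ 2 * ‖scaledCoeff 0 (m + j)‖) := by
      refine h1.trans ?_
      calc _ ≤ (((m : ℝ) + 1) * j) ^ 2 * ‖scaledCoeff 0 (m + j)‖ := by gcongr
        _ = _ := by ring
    have h4 := le_of_mul_le_mul_left h3 (by positivity)
    have : 0 ≤ ((m : ℝ) + 1) ^ 2 * ‖scaledCoeff 0 (m + j)‖ := by positivity
    linarith

/-! ### Coefficient ratios of `√(1 - u)` and transfer of nonvanishing. -/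

theorem tendsto_scaledCoeff_zero_div_succ :
    Tendsto (fun n => scaledCoeff 0 n / scaledCoeff 0 (n + 1)) atTop (𝓝 1) := by
  have h1 : Tendsto (fun n : ℕ => 1 + (3 / 2 : ℂ) * ((n : ℂ) - 1 / 2)⁻¹) atTop (𝓝 1) := by
    have : Tendsto (fun n : ℕ => ((n : ℂ) - 1 / 2)⁻¹) atTop (𝓝 0) := by
      refine tendsto_inv₀_cobounded.comp ?_
      exact (tendsto_sub_const_cobounded _).comp tendsto_natCast_atTop_cobounded
    simpa using (this.const_mul (3 / 2 : ℂ)).const_add 1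
  refine h1.congr fun n => ?_
  have h2 := succ_mul_scaledCoeff_zero_succ n
  have h3 := scaledCoeff_zero_ne_zero n
  have h4 := scaledCoeff_zero_ne_zero (n + 1)
  have h5 : (n : ℂ) - 1 / 2 ≠ 0 := by
    intro h
    rw [h, zero_mul] at h2
    exact mul_ne_zero (Nat.cast_add_one_ne_zero n) h4 h2
  rw [eq_div_iff h4]
  have h6 := mul_inv_cancel₀ h5
  linear_combination ((n : ℂ) - 1 / 2)⁻¹ * h2 - (scaledCoeff 0 (n + 1) - scaledCoeff 0 n) * h6

theorem tendsto_scaledCoeff_zero_sub_div (m : ℕ) :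
    Tendsto (fun n => scaledCoeff 0 (n - m) / scaledCoeff 0 n) atTop (𝓝 1) := by
  rw [← tendsto_add_atTop_iff_nat m]
  simp only [Nat.add_sub_cancel]
  induction m with
  | zero => simp [div_self (scaledCoeff_zero_ne_zero _)]
  | succ m ih =>
    have h := ih.mul ((tendsto_add_atTop_iff_nat m).mpr tendsto_scaledCoeff_zero_div_succ)
    rw [one_mul] at h
    refine h.congr fun n => ?_
    have := scaledCoeff_zero_ne_zero (n + m)
    have := scaledCoeff_zero_ne_zero (n + m + 1)
    rw [← add_assoc]
    field_simp

/-- Divided by `scaledCoeff 0 n`, the convolution tends to `∑ κ₀ m` by dominated convergence. The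
product filter makes this joint in the parameter and `n`. -/
theorem eventually_sum_mul_scaledCoeff_zero_ne_zero {ι : Type*} {l : Filter ι} {κ : ι → ℕ → ℂ}
    {κ₀ : ℕ → ℂ} {B q : ℝ} (hq0 : 0 ≤ q) (hq1 : q < 1)
    (hκ : ∀ m, Tendsto (fun t => κ t m) l (𝓝 (κ₀ m)))
    (hb : ∀ᶠ t in l, ∀ m, ‖κ t m‖ ≤ B * q ^ m) (hsum : ∑' m, κ₀ m ≠ 0) :
    ∀ᶠ p in l ×ˢ (atTop : Filter ℕ), ∑ ij ∈ Finset.HasAntidiagonal.antidiagonal p.2,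
      κ p.1 ij.1 * scaledCoeff 0 ij.2 ≠ 0 := by
  have hsummable : Summable fun m : ℕ => 2 * B * (((m : ℝ) + 1) ^ 2 * q ^ m) := by
    have hq : ‖q‖ < 1 := by rwa [Real.norm_of_nonneg hq0]
    have h2 := summable_pow_mul_geometric_of_norm_lt_one 2 hq
    have h1 := summable_pow_mul_geometric_of_norm_lt_one 1 hq
    have h0 := summable_pow_mul_geometric_of_norm_lt_one 0 hq
    refine (((h2.add (h1.mul_left 2)).add h0).congr fun m => ?_).mul_left _
    ring
  have hlim := tendsto_tsum_of_dominated_convergence (𝓕 := l ×ˢ (atTop : Filter ℕ))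
    (f := fun p m => if m ≤ p.2 then κ p.1 m * (scaledCoeff 0 (p.2 - m) / scaledCoeff 0 p.2) else 0)
    (g := κ₀) hsummable ?_ ?_
  · filter_upwards [hlim.eventually_ne hsum] with p hp h
    apply hp
    rw [tsum_eq_sum (s := Finset.range (p.2 + 1)) fun m hm => by
      rw [if_neg]; simpa [Nat.lt_succ_iff] using hm]
    rw [Finset.Nat.sum_antidiagonal_eq_sum_range_succ_mk] at h
    calc _ = (∑ k ∈ Finset.range p.2.succ, κ p.1 k * scaledCoeff 0 (p.2 - k)) /
          scaledCoeff 0 p.2 := by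
          rw [Finset.sum_div]
          refine Finset.sum_congr rfl fun m hm => ?_
          rw [if_pos (by simpa [Nat.lt_succ_iff] using hm), mul_div_assoc]
      _ = 0 := by rw [h, zero_div]
  · intro m
    have h1 := ((hκ m).comp tendsto_fst).mul
      ((tendsto_scaledCoeff_zero_sub_div m).comp (tendsto_snd (f := l)))
    rw [mul_one] at h1
    refine h1.congr' ?_
    filter_upwards [tendsto_snd.eventually (eventually_ge_atTop m)] with p hp
    rw [if_pos hp]
    rfl
  · filter_upwards [tendsto_fst.eventually hb] with p hp m
    have hB : 0 ≤ B := by simpa using (norm_nonneg _).trans (hp 0)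
    split_ifs with h
    · rw [norm_mul, norm_div]
      have h3 : ‖scaledCoeff 0 (p.2 - m)‖ / ‖scaledCoeff 0 p.2‖ ≤ 2 * ((m : ℝ) + 1) ^ 2 := by
        rw [div_le_iff₀ (norm_pos_iff.mpr (scaledCoeff_zero_ne_zero _))]
        exact norm_scaledCoeff_zero_sub_le h
      calc _ ≤ (B * q ^ m) * (2 * ((m : ℝ) + 1) ^ 2) := by
            gcongr
            exact hp m
        _ = _ := by ring
    · rw [norm_zero]
      positivity

/-! ### The function `gen t (t y ^ 2) - y` for fixed `t` -/

section Fixed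

variable {t : ℂ} {s r B : ℝ}

theorem norm_mul_sq_lt_of_norm_le (hrs : ‖t‖ * r ^ 2 < s) {y : ℂ} (hy : ‖y‖ ≤ r) :
    ‖t * y ^ 2‖ < s := by
  rw [norm_mul, norm_pow]
  exact lt_of_le_of_lt (by gcongr) hrs

theorem differentiableOn_gen_mul_sq (hs : 0 < s) (h : ∀ n, ‖scaledCoeff t n‖ * s ^ n ≤ B)
    (hrs : ‖t‖ * r ^ 2 < s) : DifferentiableOn ℂ (fun y => gen t (t * y ^ 2)) (ball 0 r) :=
  (differentiableOn_gen hs h).comp (g := gen t) (f := fun y => t * y ^ 2) (by fun_prop) fun y hy => by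
    rw [mem_ball_zero_iff] at hy ⊢
    exact norm_mul_sq_lt_of_norm_le hrs hy.le

theorem gen_mul_sq_functional (hs : 0 < s) (h : ∀ n, ‖scaledCoeff t n‖ * s ^ n ≤ B)
    (hrs : ‖t‖ * r ^ 2 < s) (htr : ‖t‖ * r ≤ 1) {y : ℂ} (hy : y ∈ ball (0 : ℂ) r) :
    gen t (t * (t * y ^ 2) ^ 2) = gen t (t * y ^ 2) ^ 2 + t * y ^ 2 := by
  have h1 := norm_mul_sq_lt_of_norm_le hrs (mem_ball_zero_iff.mp hy).le
  have h2 := norm_mul_sq_lt_of_norm_le hrs (mem_ball_zero_iff.mp (mul_sq_mem_ball htr hy)).le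
  rw [gen_sq hs h h1 h2]
  ring

theorem eq_of_gen_mul_sq_eq (hs : 0 < s) (h : ∀ n, ‖scaledCoeff t n‖ * s ^ n ≤ B)
    (hrs : ‖t‖ * r ^ 2 < s) (htr : ‖t‖ * r ≤ 1) {y z : ℂ} (hy : y ∈ ball (0 : ℂ) r)
    (hz : z ∈ ball (0 : ℂ) r) (hgy : gen t (t * y ^ 2) = y) (hgz : gen t (t * z ^ 2) = z) :
    y = z := by
  by_cases ht : t = 0
  · rw [ht, zero_mul, gen_zero_right] at hgy hgz
    rw [← hgy, ← hgz]
  · exact eq_of_isFixedPt (A := fun y => gen t (t * y ^ 2)) ht (pos_of_mem_ball hy) htr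
      (differentiableOn_gen_mul_sq hs h hrs) (by simp [gen_zero_right]) (fun y => by simp)
      (fun y hy => gen_mul_sq_functional hs h hrs htr hy) hy hz hgy hgz

theorem deriv_gen_mul_sq_sub_ne_zero (hs : 0 < s) (h : ∀ n, ‖scaledCoeff t n‖ * s ^ n ≤ B)
    (hrs : ‖t‖ * r ^ 2 < s) (htr : ‖t‖ * r ≤ 1) {y : ℂ} (hy : y ∈ ball (0 : ℂ) r)
    (hgy : gen t (t * y ^ 2) = y) : deriv (fun y => gen t (t * y ^ 2) - y) y ≠ 0 := by
  have hd := differentiableOn_gen_mul_sq hs h hrs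
  have hdy := hd.differentiableAt (isOpen_ball.mem_nhds hy)
  have h1 := deriv_ne_one_of_isFixedPt (A := fun y => gen t (t * y ^ 2)) (pos_of_mem_ball hy) htr hd
    (by simp [gen_zero_right]) (fun y hy => gen_mul_sq_functional hs h hrs htr hy) hy hgy
  have h2 : HasDerivAt (fun y => gen t (t * y ^ 2) - y) (deriv (fun y => gen t (t * y ^ 2)) y - 1) y :=
    hdy.hasDerivAt.sub (hasDerivAt_id y)
  rw [h2.deriv]
  exact sub_ne_zero.mpr h1

theorem taylorSeries_one_sub_mul (b : ℂ) :
    taylorSeries (fun y => 1 - y * b) = 1 - PowerSeries.C b * PowerSeries.X := by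
  rw [taylorSeries_eq_of_hasSum
    (a := fun n => (if n = 0 then 1 else 0) - if n = 1 then b else 0) (.of_forall fun z => ?_)]
  · ext n
    simp [PowerSeries.coeff_one, PowerSeries.coeff_X]
  · refine HasSum.congr_fun ((hasSum_ite_eq 0 (1 : ℂ)).sub (hasSum_ite_eq 1 (z * b))) fun n => ?_
    split_ifs <;> simp_all [mul_comm]

/-- Both sides expand `g_t(y)^2`. Taking `b = 0` serves the zero-free case, `b = 1/a` the case of a
simple zero `a`. -/
theorem taylorSeries_sq_mul_eq (hs : 0 < s) (h : ∀ n, ‖scaledCoeff t n‖ * s ^ n ≤ B) {K : ℂ → ℂ}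
    (hK : AnalyticAt ℂ K 0) {b : ℂ}
    (hKb : ∀ᶠ y in 𝓝 0, K y ^ 2 * (1 - y * b) = gen t (t * y ^ 2) - y) :
    taylorSeries K ^ 2 * (1 - PowerSeries.C b * PowerSeries.X) =
      PowerSeries.mk (scaledCoeff t) ^ 2 := by
  have hg : AnalyticAt ℂ (gen t) 0 := (differentiableOn_gen hs h).analyticAt (ball_mem_nhds 0 hs)
  have hb : AnalyticAt ℂ (fun y => 1 - y * b) 0 := by fun_prop
  rw [← taylorSeries_gen hs h, sq, sq, ← taylorSeries_mul hg hg, ← taylorSeries_one_sub_mul,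
    ← taylorSeries_mul hK hK, ← taylorSeries_mul (hK.mul hK) hb]
  refine taylorSeries_congr ?_
  have hev : ∀ᶠ y : ℂ in 𝓝 0, ‖t * y ^ 2‖ < s :=
    ContinuousAt.eventually_lt (by fun_prop) continuousAt_const (by simpa using hs)
  filter_upwards [hKb, ball_mem_nhds (0 : ℂ) hs, hev] with y h1 h2 h3
  have := gen_sq hs h (mem_ball_zero_iff.mp h2) h3
  simp only [Pi.mul_apply]
  rw [← sq, ← sq, h1, this]

end Fixed

/-! ### Local uniformity in `t` -/

/-- The generating functions `gen t`, for `t` near `t₀`, are uniformly controlled on the disc of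
radius `s`. -/
structure UniformRadius (t₀ : ℂ) (s : ℝ) : Prop where
  pos : 0 < s
  bound : ∃ B, ∀ᶠ t in 𝓝 t₀, ∀ n, ‖scaledCoeff t n‖ * s ^ n ≤ B

variable {t₀ : ℂ} {s r : ℝ}

theorem UniformRadius.mono (h : UniformRadius t₀ s) {s' : ℝ} (hs' : 0 < s') (hle : s' ≤ s) :
    UniformRadius t₀ s' := by
  obtain ⟨B, hB⟩ := h.bound
  refine ⟨hs', B, hB.mono fun t ht n => le_trans ?_ (ht n)⟩
  gcongr

theorem exists_uniformRadius (t₀ : ℂ) : ∃ s, UniformRadius t₀ s := by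
  have hD : 0 < 4 * (‖t₀‖ + 1) := by positivity
  refine ⟨(4 * (‖t₀‖ + 1))⁻¹, inv_pos.mpr hD, 1, ?_⟩
  have : ∀ᶠ t in 𝓝 t₀, ‖t‖ < ‖t₀‖ + 1 :=
    ContinuousAt.eventually_lt (by fun_prop) continuousAt_const (by linarith)
  filter_upwards [this] with t ht n
  have := norm_scaledCoeff_le (by linarith [norm_nonneg t₀]) ht.le n
  rw [inv_pow, ← div_eq_mul_inv, div_le_one (by positivity)]
  exact this

theorem UniformRadius.continuousAt_gen (h : UniformRadius t₀ s) {u : ℂ} (hu : ‖u‖ < s) :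
    ContinuousAt (fun p : ℂ × ℂ => gen p.1 p.2) (t₀, u) := by
  obtain ⟨B, hB⟩ := h.bound
  obtain ⟨σ, huσ, hσs⟩ := exists_between hu
  have hs := h.pos
  have hσ : 0 ≤ σ := (norm_nonneg u).trans huσ.le
  set V := {t | ∀ n, ‖scaledCoeff t n‖ * s ^ n ≤ B}
  have hcont : ContinuousOn (fun p : ℂ × ℂ => gen p.1 p.2) (V ×ˢ ball 0 σ) := by
    refine continuousOn_tsum (u := fun n => B * (σ / s) ^ n)
      (fun n => (((continuous_scaledCoeff n).comp continuous_fst).mul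
        (continuous_snd.pow n)).continuousOn)
      ((summable_geometric_of_lt_one (by positivity) ((div_lt_one hs).mpr hσs)).mul_left B) ?_
    rintro n ⟨t, w⟩ ⟨ht, hw⟩
    refine (norm_scaledCoeff_mul_pow_le hs ht w n).trans ?_
    have hB0 : 0 ≤ B := le_trans (by positivity) (ht 0)
    have := (mem_ball_zero_iff.mp hw).le
    gcongr
  exact hcont.continuousAt (prod_mem_nhds hB (isOpen_ball.mem_nhds (mem_ball_zero_iff.mpr huσ)))

theorem UniformRadius.continuousAt_gen_mul_sq_sub (h : UniformRadius t₀ s)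
    (hrs : ‖t₀‖ * r ^ 2 < s) {y : ℂ} (hy : ‖y‖ ≤ r) :
    ContinuousAt (fun p : ℂ × ℂ => gen p.1 (p.1 * p.2 ^ 2) - p.2) (t₀, y) := by
  refine ContinuousAt.sub ?_ continuousAt_snd
  exact ContinuousAt.comp (g := fun p : ℂ × ℂ => gen p.1 p.2)
    (f := fun p : ℂ × ℂ => (p.1, p.1 * p.2 ^ 2)) (x := (t₀, y))
    (h.continuousAt_gen (norm_mul_sq_lt_of_norm_le hrs hy)) (by fun_prop)

theorem UniformRadius.exists_bound_gen_mul_sq_sub (h : UniformRadius t₀ s)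
    (hrs : ‖t₀‖ * r ^ 2 < s) :
    ∃ M, 0 ≤ M ∧ ∀ᶠ t in 𝓝 t₀, ∀ y ∈ closedBall (0 : ℂ) r, ‖gen t (t * y ^ 2) - y‖ ≤ M := by
  have hc : ContinuousOn (fun y => gen t₀ (t₀ * y ^ 2) - y) (closedBall 0 r) := fun y hy =>
    (ContinuousAt.comp (g := fun p : ℂ × ℂ => gen p.1 (p.1 * p.2 ^ 2) - p.2)
      (f := fun y => (t₀, y)) (x := y)
      (h.continuousAt_gen_mul_sq_sub hrs (mem_closedBall_zero_iff.mp hy))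
      (by fun_prop)).continuousWithinAt
  obtain ⟨M, hM⟩ := (isCompact_closedBall (0 : ℂ) r).exists_bound_of_continuousOn hc
  refine ⟨max M 0 + 1, by positivity, ?_⟩
  refine (isCompact_closedBall (0 : ℂ) r).eventually_forall_of_forall_eventually
    (P := fun t y => ‖gen t (t * y ^ 2) - y‖ ≤ max M 0 + 1) fun y hy => ?_
  have := (h.continuousAt_gen_mul_sq_sub hrs (mem_closedBall_zero_iff.mp hy)).norm
  refine (this.eventually_lt continuousAt_const (g := fun _ => max M 0 + 1) ?_).mono fun _ h => h.le
  exact lt_of_le_of_lt ((hM y hy).trans (le_max_left _ _)) (by linarith)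

theorem eventually_norm_mul_sq_lt (hrs : ‖t₀‖ * r ^ 2 < s) : ∀ᶠ t in 𝓝 t₀, ‖t‖ * r ^ 2 < s :=
  ContinuousAt.eventually_lt (by fun_prop) continuousAt_const hrs

/-- By compactness `F_t` stays zero-free on the closed disc for `t` near `t₀`. Its root there must
be `g_t`, and Cauchy's estimate on the circle of radius `r'` bounds the coefficients; `‖K‖ ^ 2 ≤ M`
gives `‖K‖ ≤ M + 1`. -/
theorem UniformRadius.extend (h : UniformRadius t₀ s) (hrs : ‖t₀‖ * r ^ 2 < s)
    (hne : ∀ y ∈ closedBall (0 : ℂ) r, gen t₀ (t₀ * y ^ 2) ≠ y) {r' : ℝ} (hr' : 0 < r')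
    (hr'r : r' < r) : UniformRadius t₀ r' := by
  obtain ⟨B, hB⟩ := h.bound
  obtain ⟨M, hM0, hM⟩ := h.exists_bound_gen_mul_sq_sub hrs
  have hne' : ∀ᶠ t in 𝓝 t₀, ∀ y ∈ closedBall (0 : ℂ) r, gen t (t * y ^ 2) - y ≠ 0 :=
    (isCompact_closedBall (0 : ℂ) r).eventually_forall_of_forall_eventually
      (P := fun t y => gen t (t * y ^ 2) - y ≠ 0) fun y hy =>
      (h.continuousAt_gen_mul_sq_sub hrs (mem_closedBall_zero_iff.mp hy)).eventually_ne
        (sub_ne_zero.mpr (hne y hy))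
  refine ⟨hr', M + 1, ?_⟩
  filter_upwards [hB, hM, hne', eventually_norm_mul_sq_lt hrs] with t ht hMt hnet hrst n
  have hball : ball (0 : ℂ) r ∈ 𝓝 (0 : ℂ) := ball_mem_nhds _ (hr'.trans hr'r)
  obtain ⟨K, hK, hK0, hK2⟩ := exists_sq_eq_of_ne_zero (r := r) (F := fun y => gen t (t * y ^ 2) - y)
    ((differentiableOn_gen_mul_sq h.pos ht hrst).sub differentiableOn_id) (by simp [gen_zero_right])
    (fun y hy => hnet y (ball_subset_closedBall hy))
  have hT := taylorSeries_sq_mul_eq h.pos ht (hK.analyticAt hball) (b := 0)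
    (by filter_upwards [hball] with y hy using by rw [mul_zero, sub_zero, mul_one, hK2 y hy])
  rw [map_zero, zero_mul, sub_zero, mul_one] at hT
  have hT2 := powerSeries_eq_of_sq_eq hT (by rw [constantCoeff_taylorSeries, hK0])
    (by rw [← PowerSeries.coeff_zero_eq_constantCoeff_apply]; simp [scaledCoeff_zero])
  have := norm_coeff_taylorSeries_le hr' hr'r hK (B := M + 1) (fun z hz => ?_) n
  · rwa [hT2, PowerSeries.coeff_mk] at this
  · have hz' : z ∈ ball (0 : ℂ) r := sphere_subset_closedBall.trans (closedBall_subset_ball hr'r) hz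
    have h1 := hMt z (ball_subset_closedBall hz')
    rw [← hK2 z hz', norm_pow] at h1
    nlinarith [norm_nonneg (K z)]

/-! ### The dominant singularity -/

theorem exists_zero_gen_mul_sq_sub (ht₀ : t₀ ≠ 0 → t₀⁻¹ ∉ mandelbrotSet) :
    ∃ r s : ℝ, UniformRadius t₀ s ∧ ‖t₀‖ * r ^ 2 < s ∧ ‖t₀‖ * r < 1 ∧
      ∃ y ∈ ball (0 : ℂ) r, gen t₀ (t₀ * y ^ 2) = y := by
  obtain ⟨s₀, hs₀⟩ := exists_uniformRadius t₀
  by_cases ht : t₀ = 0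
  · refine ⟨2, s₀, hs₀, by simpa [ht] using hs₀.pos, by simp [ht], 1, by simp, ?_⟩
    rw [ht, zero_mul, gen_zero_right]
  by_contra! H
  have hτ : 0 < ‖t₀‖ := norm_pos_iff.mpr ht
  have extend : ∀ r s : ℝ, UniformRadius t₀ s → 0 < r → ‖t₀‖ * r ^ 2 < s → ‖t₀‖ * r < 1 →
      UniformRadius t₀ r := by
    intro r s hs hr hrs hr1
    have h1 : ∀ᶠ r' in 𝓝 r, ‖t₀‖ * r' ^ 2 < s :=
      ContinuousAt.eventually_lt (by fun_prop) continuousAt_const hrs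
    have h1' : ∀ᶠ r' in 𝓝 r, ‖t₀‖ * r' < 1 :=
      ContinuousAt.eventually_lt (by fun_prop) continuousAt_const hr1
    obtain ⟨r₂, ⟨h2, h3⟩, h4⟩ :=
      (((h1.and h1').filter_mono nhdsWithin_le_nhds).and (self_mem_nhdsWithin (s := Set.Ioi r))).exists
    obtain ⟨r₁, h5, h6⟩ := exists_between (show r < r₂ from h4)
    have hr₁ : 0 < r₁ := hr.trans h5
    have h7 : ‖t₀‖ * r₁ ^ 2 < s := lt_of_le_of_lt (by gcongr) h2
    exact hs.extend h7
      (fun y hy => H r₂ s hs h2 h3 y (closedBall_subset_ball h6 hy)) hr h5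
  -- Without zeros the radius improves itself: when `|t₀| ρ < 1` one has `|t₀| ρ ^ 2 < ρ`, so some
  -- radius above the supremum `ρ` is also attained.
  have hall : ∀ s, 0 < s → s < ‖t₀‖⁻¹ → UniformRadius t₀ s := by
    by_contra! hcon
    obtain ⟨s₁, hs₁, hs₁', hbad⟩ := hcon
    set S := {s | UniformRadius t₀ s} with hS
    have hub : ∀ s ∈ S, s < s₁ := fun s hs => not_le.mp fun hle => hbad (hs.mono hs₁ hle)
    have hbdd : BddAbove S := ⟨s₁, fun s hs => (hub s hs).le⟩
    have hne : S.Nonempty := ⟨s₀, hs₀⟩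
    set ρ := sSup S
    have hρ0 : 0 < ρ := hs₀.pos.trans_le (le_csSup hbdd hs₀)
    have hρ1 : ‖t₀‖ * ρ < 1 := by
      have : ρ < ‖t₀‖⁻¹ := (csSup_le hne fun s hs => (hub s hs).le).trans_lt hs₁'
      calc ‖t₀‖ * ρ < ‖t₀‖ * ‖t₀‖⁻¹ := by gcongr
        _ = 1 := mul_inv_cancel₀ hτ.ne'
    have hρ2 : ‖t₀‖ * ρ ^ 2 < ρ := by nlinarith
    have h1 : ∀ᶠ r in 𝓝 ρ, ‖t₀‖ * r ^ 2 < ρ :=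
      ContinuousAt.eventually_lt (by fun_prop) continuousAt_const hρ2
    have h1' : ∀ᶠ r in 𝓝 ρ, ‖t₀‖ * r < 1 :=
      ContinuousAt.eventually_lt (by fun_prop) continuousAt_const hρ1
    obtain ⟨r, ⟨h2, h3⟩, h4⟩ :=
      (((h1.and h1').filter_mono nhdsWithin_le_nhds).and (self_mem_nhdsWithin (s := Set.Ioi ρ))).exists
    obtain ⟨s, hsS, hs⟩ := exists_lt_of_lt_csSup hne h2
    have h5 : r ∈ S := extend r s hsS (hρ0.trans h4) hs h3
    exact absurd (le_csSup hbdd h5) (not_le.mpr h4)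
  have hbetween : ∀ y ∈ ball (0 : ℂ) ‖t₀⁻¹‖, ∃ r : ℝ, y ∈ ball (0 : ℂ) r ∧ UniformRadius t₀ r ∧
      ‖t₀‖ * r ^ 2 < r ∧ ‖t₀‖ * r < 1 := by
    intro y hy
    rw [mem_ball_zero_iff, norm_inv] at hy
    obtain ⟨r, h1, h2⟩ := exists_between hy
    have hr : 0 < r := (norm_nonneg y).trans_lt h1
    have h3 : ‖t₀‖ * r < 1 := by
      calc ‖t₀‖ * r < ‖t₀‖ * ‖t₀‖⁻¹ := by gcongr
        _ = 1 := mul_inv_cancel₀ hτ.ne'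
    exact ⟨r, mem_ball_zero_iff.mpr h1, hall r hr h2, by nlinarith, h3⟩
  have hd : DifferentiableOn ℂ (fun y => gen t₀ (t₀ * y ^ 2)) (ball 0 ‖t₀⁻¹‖) := by
    intro y hy
    obtain ⟨r, hyr, hr, hr2, -⟩ := hbetween y hy
    obtain ⟨B, hB⟩ := hr.bound
    exact ((differentiableOn_gen_mul_sq hr.pos hB.self_of_nhds hr2).differentiableAt
      (isOpen_ball.mem_nhds hyr)).differentiableWithinAt
  obtain ⟨y, hy, hyA⟩ := exists_isFixedPt_of_notMem_mandelbrotSet (inv_ne_zero ht) (ht₀ ht) hd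
    (by simp [gen_zero_right]) (fun y => by simp) fun y hy => by
      obtain ⟨r, hyr, hr, hr2, hr1⟩ := hbetween y hy
      obtain ⟨B, hB⟩ := hr.bound
      rw [inv_inv]
      exact gen_mul_sq_functional hr.pos hB.self_of_nhds hr2 hr1.le hyr
  obtain ⟨r, hyr, hr, hr2, hr1⟩ := hbetween y hy
  exact H r r hr hr2 hr1 y hyr hyA

/-- Hurwitz by the maximum principle: for `t` near `t₀`, `F_t` is larger than `m / 2` on a small
circle about `y₀` and smaller at `y₀`, which is impossible for `1 / F_t` analytic inside. -/
theorem UniformRadius.eventually_exists_zero (h : UniformRadius t₀ s) (hrs : ‖t₀‖ * r ^ 2 < s)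
    (htr : ‖t₀‖ * r < 1) {y₀ : ℂ} (hy₀ : y₀ ∈ ball (0 : ℂ) r) (hgy₀ : gen t₀ (t₀ * y₀ ^ 2) = y₀)
    {δ : ℝ} (hδ : 0 < δ) :
    ∀ᶠ t in 𝓝 t₀, ∃ y ∈ ball (0 : ℂ) r, dist y y₀ < δ ∧ gen t (t * y ^ 2) = y := by
  obtain ⟨B, hB⟩ := h.bound
  obtain ⟨ε, hε, hεδ, hεr⟩ : ∃ ε > 0, ε < δ ∧ closedBall y₀ ε ⊆ ball 0 r := by
    obtain ⟨ε, hε, hsub⟩ := nhds_basis_closedBall.mem_iff.mp (isOpen_ball.mem_nhds hy₀)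
    exact ⟨min ε (δ / 2), by positivity, (min_le_right _ _).trans_lt (by linarith),
      (closedBall_subset_closedBall (min_le_left _ _)).trans hsub⟩
  have hsr : ∀ z ∈ sphere y₀ ε, z ∈ ball (0 : ℂ) r := fun z hz => hεr (sphere_subset_closedBall hz)
  have hcont := fun z (hz : z ∈ ball (0 : ℂ) r) =>
    h.continuousAt_gen_mul_sq_sub hrs (mem_ball_zero_iff.mp hz).le
  have hc : ∀ z ∈ ball (0 : ℂ) r, ContinuousAt (fun y => gen t₀ (t₀ * y ^ 2) - y) z := fun z hz =>
    ContinuousAt.comp (g := fun p : ℂ × ℂ => gen p.1 (p.1 * p.2 ^ 2) - p.2)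
      (f := fun y => (t₀, y)) (x := z) (hcont z hz) (by fun_prop)
  obtain ⟨m, hm0, hm⟩ := (isCompact_sphere y₀ ε).exists_forall_le' (a := 0)
    (f := fun y => ‖gen t₀ (t₀ * y ^ 2) - y‖)
    (fun z hz => (hc z (hsr z hz)).norm.continuousWithinAt) fun z hz => by
      rw [norm_pos_iff, sub_ne_zero]
      intro hz0
      have := eq_of_gen_mul_sq_eq h.pos hB.self_of_nhds hrs htr.le (hsr z hz) hy₀ hz0 hgy₀
      rw [this, mem_sphere, dist_self] at hz
      exact hε.ne hz
  have h1 : ∀ᶠ t in 𝓝 t₀, ∀ z ∈ sphere y₀ ε, m / 2 < ‖gen t (t * z ^ 2) - z‖ :=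
    (isCompact_sphere y₀ ε).eventually_forall_of_forall_eventually
      (P := fun t z => m / 2 < ‖gen t (t * z ^ 2) - z‖) fun z hz =>
      continuousAt_const.eventually_lt (hcont z (hsr z hz)).norm
        (lt_of_lt_of_le (by linarith) (hm z hz))
  have h2 : ∀ᶠ t in 𝓝 t₀, ‖gen t (t * y₀ ^ 2) - y₀‖ < m / 2 := by
    have : ContinuousAt (fun t => gen t (t * y₀ ^ 2) - y₀) t₀ :=
      ContinuousAt.comp (g := fun p : ℂ × ℂ => gen p.1 (p.1 * p.2 ^ 2) - p.2)
        (f := fun t => (t, y₀)) (x := t₀) (hcont y₀ hy₀) (by fun_prop)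
    exact this.norm.eventually_lt continuousAt_const (by rw [hgy₀, sub_self, norm_zero]; linarith)
  filter_upwards [hB, eventually_norm_mul_sq_lt hrs, h1, h2] with t ht hrst h1t h2t
  by_contra! hno
  have hne : ∀ z ∈ closedBall y₀ ε, gen t (t * z ^ 2) - z ≠ 0 := fun z hz =>
    sub_ne_zero.mpr (hno z (hεr hz) ((mem_closedBall.mp hz).trans_lt hεδ))
  have hd : DifferentiableOn ℂ (fun z => (gen t (t * z ^ 2) - z)⁻¹) (closedBall y₀ ε) :=
    (((differentiableOn_gen_mul_sq h.pos ht hrst).sub differentiableOn_id).mono hεr).inv hne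
  have hmax := Complex.norm_le_of_forall_mem_frontier_norm_le (C := (m / 2)⁻¹) isBounded_ball
    (hd.diffContOnCl_ball subset_rfl) (fun z hz => by
      rw [frontier_ball y₀ hε.ne'] at hz
      rw [norm_inv]
      exact inv_anti₀ (by linarith) (h1t z hz).le) (subset_closure (mem_ball_self hε))
  rw [norm_inv, inv_le_inv₀ (norm_pos_iff.mpr (hne y₀ (mem_closedBall_self hε.le))) (by linarith)]
    at hmax
  linarith

theorem UniformRadius.exists_zero_function (h : UniformRadius t₀ s) (hrs : ‖t₀‖ * r ^ 2 < s)
    (htr : ‖t₀‖ * r < 1) {y₀ : ℂ} (hy₀ : y₀ ∈ ball (0 : ℂ) r) (hgy₀ : gen t₀ (t₀ * y₀ ^ 2) = y₀) :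
    ∃ a : ℂ → ℂ, Tendsto a (𝓝 t₀) (𝓝 y₀) ∧
      ∀ᶠ t in 𝓝 t₀, a t ∈ ball (0 : ℂ) r ∧ gen t (t * a t ^ 2) = a t := by
  classical
  obtain ⟨B, hB⟩ := h.bound
  -- The choice does not involve `δ`; uniqueness of the zero identifies it with the one found near
  -- `y₀`.
  set a : ℂ → ℂ := fun t =>
    if h : ∃ y ∈ ball (0 : ℂ) r, gen t (t * y ^ 2) = y then h.choose else 0 with ha
  have hev : ∀ {δ : ℝ}, 0 < δ → _ := fun hδ => h.eventually_exists_zero hrs htr hy₀ hgy₀ hδ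
  have hspec : ∀ t, (∃ y ∈ ball (0 : ℂ) r, gen t (t * y ^ 2) = y) →
      a t ∈ ball (0 : ℂ) r ∧ gen t (t * a t ^ 2) = a t := by
    intro t ht
    simp only [ha, dif_pos ht]
    exact ht.choose_spec
  have htr' : ∀ᶠ t in 𝓝 t₀, ‖t‖ * r < 1 :=
    ContinuousAt.eventually_lt (by fun_prop) continuousAt_const htr
  refine ⟨a, ?_, (hev one_pos).mono fun t ⟨y, hy, _, hgy⟩ => hspec t ⟨y, hy, hgy⟩⟩
  rw [Metric.tendsto_nhds]
  intro δ hδ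
  filter_upwards [hev hδ, hB, eventually_norm_mul_sq_lt hrs, htr'] with t hzero ht h1 h2
  obtain ⟨y, hy, hyδ, hgy⟩ := hzero
  obtain ⟨h3, h4⟩ := hspec t ⟨y, hy, hgy⟩
  rwa [eq_of_gen_mul_sq_eq h.pos ht h1 h2.le h3 hy h4 hgy]

theorem eventually_scaledCoeff_ne_zero (ht₀ : t₀ ≠ 0 → t₀⁻¹ ∉ mandelbrotSet) :
    ∀ᶠ p in 𝓝 t₀ ×ˢ (atTop : Filter ℕ), scaledCoeff p.1 p.2 ≠ 0 := by
  obtain ⟨r, s, h, hrs, htr, y₀, hy₀, hgy₀⟩ := exists_zero_gen_mul_sq_sub ht₀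
  obtain ⟨a, ha, hazero⟩ := h.exists_zero_function hrs htr hy₀ hgy₀
  obtain ⟨B, hB⟩ := h.bound
  obtain ⟨M, hM0, hM⟩ := h.exists_bound_gen_mul_sq_sub hrs
  obtain ⟨r₁, hr₁, hr₁r⟩ := exists_between (mem_ball_zero_iff.mp hy₀)
  obtain ⟨r₂, hr₁₂, hr₂⟩ := exists_between hr₁r
  have hr₁0 : 0 < r₁ := (norm_nonneg _).trans_lt hr₁
  have hr₂0 : 0 < r₂ := hr₁0.trans hr₁₂
  have htr' : ∀ᶠ t in 𝓝 t₀, ‖t‖ * r < 1 :=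
    ContinuousAt.eventually_lt (by fun_prop) continuousAt_const htr
  have har₁ : ∀ᶠ t in 𝓝 t₀, ‖a t‖ < r₁ := ha.norm.eventually_lt_const hr₁
  set S : PowerSeries ℂ := PowerSeries.mk (scaledCoeff 0) with hSdef
  have hS0 : PowerSeries.constantCoeff S = 1 := by
    rw [← PowerSeries.coeff_zero_eq_constantCoeff_apply]
    simp [hSdef, scaledCoeff_zero]
  -- `κ t` is the series of `K_t(a(t) u)`. As a formal quotient its coefficients are visibly
  -- continuous at `t₀`, without tracking how `K_t` depends on `t`.
  set κ : ℂ → PowerSeries ℂ := fun t =>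
    PowerSeries.rescale (a t) (PowerSeries.mk (scaledCoeff t)) * S⁻¹ with hκ
  -- On `|z| = r₂` one has `|1 - z / a t| ≥ r₂ / r₁ - 1`, so `‖K‖ ^ 2 ≤ D - 1` and `‖K‖ ≤ D`.
  set D : ℝ := M / (r₂ / r₁ - 1) + 1 with hD
  have hκS : ∀ t, κ t * S = PowerSeries.rescale (a t) (PowerSeries.mk (scaledCoeff t)) := fun t => by
    rw [hκ, mul_assoc, PowerSeries.inv_mul_cancel _ (by rw [hS0]; exact one_ne_zero), mul_one]
  have key : ∀ᶠ t in 𝓝 t₀, (∀ m, ‖PowerSeries.coeff m (κ t)‖ ≤ D * (r₁ / r₂) ^ m) ∧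
      ∑' m, PowerSeries.coeff m (κ t) ≠ 0 := by
    filter_upwards [hazero, hB, hM, htr', har₁, eventually_norm_mul_sq_lt hrs]
      with t ⟨hat, hgat⟩ hBt hMt htrt hart hrst
    have ha0 : a t ≠ 0 := by
      intro h0
      rw [h0] at hgat
      simp [gen_zero_right] at hgat
    have hball : ball (0 : ℂ) r ∈ 𝓝 (0 : ℂ) := isOpen_ball.mem_nhds
      (mem_ball_self (pos_of_mem_ball hat))
    obtain ⟨K, hK, hK0, hKa, hKeq⟩ := exists_sq_mul_eq_of_simple_zero (r := r) (a := a t)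
      (F := fun y => gen t (t * y ^ 2) - y)
      ((differentiableOn_gen_mul_sq h.pos hBt hrst).sub differentiableOn_id)
      (by simp [gen_zero_right]) hat (sub_eq_zero.mpr hgat)
      (deriv_gen_mul_sq_sub_ne_zero h.pos hBt hrst htrt.le hat hgat)
      (fun z hz hz0 => eq_of_gen_mul_sq_eq h.pos hBt hrst htrt.le hz hat (sub_eq_zero.mp hz0) hgat)
    have hT := taylorSeries_sq_mul_eq h.pos hBt (hK.analyticAt hball) (b := (a t)⁻¹)
      (by filter_upwards [hball] with y hy using by rw [← div_eq_mul_inv, hKeq y hy])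
    have hT1 : PowerSeries.rescale (a t) (taylorSeries K) * S =
        PowerSeries.rescale (a t) (PowerSeries.mk (scaledCoeff t)) := by
      refine powerSeries_eq_of_sq_eq ?_ ?_ ?_
      · have := congrArg (PowerSeries.rescale (a t)) hT
        rw [map_mul, map_pow, map_pow, map_sub, map_one, map_mul, PowerSeries.rescale_X] at this
        have hC : PowerSeries.rescale (a t) (PowerSeries.C (a t)⁻¹) = PowerSeries.C (a t)⁻¹ := by
          ext n
          rw [PowerSeries.coeff_rescale, PowerSeries.coeff_C]
          split_ifs with hn <;> simp [hn]
        rw [hC, ← mul_assoc, ← map_mul, inv_mul_cancel₀ ha0, map_one, one_mul] at this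
        rw [mul_pow, mk_scaledCoeff_zero_sq, this]
      · rw [map_mul, hS0, mul_one, ← PowerSeries.coeff_zero_eq_constantCoeff_apply,
          PowerSeries.coeff_rescale, pow_zero, one_mul, PowerSeries.coeff_zero_eq_constantCoeff_apply,
          constantCoeff_taylorSeries, hK0]
      · rw [← PowerSeries.coeff_zero_eq_constantCoeff_apply, PowerSeries.coeff_rescale]
        simp [scaledCoeff_zero]
    have hκt : κ t = PowerSeries.rescale (a t) (taylorSeries K) := by
      have hSne : S ≠ 0 := by
        intro h0
        rw [h0, map_zero] at hS0
        exact zero_ne_one hS0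
      exact mul_right_cancel₀ hSne ((hκS t).trans hT1.symm)
    constructor
    · intro m
      have hb := norm_coeff_taylorSeries_le hr₂0 hr₂ hK (B := D) (fun z hz => ?_) m
      · rw [hκt, PowerSeries.coeff_rescale, norm_mul, norm_pow, div_pow]
        calc _ ≤ r₁ ^ m * (D / r₂ ^ m) := by
              gcongr
              rwa [le_div_iff₀ (by positivity)]
          _ = _ := by ring
      · have hz' : z ∈ ball (0 : ℂ) r :=
          sphere_subset_closedBall.trans (closedBall_subset_ball hr₂) hz
        have h1 := hMt z (ball_subset_closedBall hz')
        rw [← hKeq z hz', norm_mul, norm_pow] at h1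
        have hgap : 0 < r₂ / r₁ - 1 := by rw [sub_pos, one_lt_div hr₁0]; exact hr₁₂
        have h2 : r₂ / r₁ - 1 ≤ ‖1 - z / a t‖ := by
          have h3 : r₂ / r₁ ≤ ‖z / a t‖ := by
            rw [norm_div, mem_sphere_zero_iff_norm.mp hz]
            have := norm_pos_iff.mpr ha0
            gcongr
          have h4 := norm_sub_norm_le (z / a t) 1
          rw [norm_one, norm_sub_rev] at h4
          linarith
        have h5 : ‖K z‖ ^ 2 ≤ M / (r₂ / r₁ - 1) := by
          rw [le_div_iff₀ hgap]
          exact le_trans (by gcongr) h1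
        nlinarith [norm_nonneg (K z)]
    -- The sum is `K_t(a t)`, nonzero because the zero is simple.
    · have hsum := hasSum_taylorSeries hK hat
      rw [hκt]
      simp only [PowerSeries.coeff_rescale, mul_comm _ (PowerSeries.coeff _ _)]
      rwa [hsum.tsum_eq]
  have hcont : ∀ m, Tendsto (fun t => PowerSeries.coeff m (κ t)) (𝓝 t₀)
      (𝓝 (PowerSeries.coeff m (κ t₀))) := by
    intro m
    have hat₀ : ContinuousAt a t₀ := by
      rw [ContinuousAt, eq_of_tendsto_nhds ha]
      exact ha
    simp only [hκ, PowerSeries.coeff_mul, PowerSeries.coeff_rescale, PowerSeries.coeff_mk]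
    exact tendsto_finsetSum _ fun i _ =>
      ((hat₀.tendsto.pow _).mul (continuous_scaledCoeff _).continuousAt.tendsto).mul_const _
  have hmain := eventually_sum_mul_scaledCoeff_zero_ne_zero (κ := fun t m => PowerSeries.coeff m (κ t))
    (by positivity) ((div_lt_one hr₂0).mpr hr₁₂) hcont (key.mono fun _ h => h.1) key.self_of_nhds.2
  refine hmain.mono fun p hp h0 => hp ?_
  have := congrArg (PowerSeries.coeff p.2) (hκS p.1)
  rw [PowerSeries.coeff_mul, PowerSeries.coeff_rescale, PowerSeries.coeff_mk, h0, mul_zero] at this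
  simpa only [hSdef, PowerSeries.coeff_mk] using this

end MandelbrotPoly

/-! ### Compactness in the parameter `t = 1/c`. -/

theorem mainTheorem5 (U : Set ℂ) (hU : IsOpen U) (hM : mandelbrotSet ⊆ U) :
    ∃ N : ℕ, ∀ n : ℕ, n > N → ∀ c : ℂ, c ∉ U → aeval (-c / 2) (mandelbrotPoly n) ≠ 0 := by
  have h0U : (0 : ℂ) ∈ U := hM <| by
    have : ∀ n, (fun z : ℂ => z ^ 2 + 0)^[n] 0 = 0 := fun n =>
      Function.iterate_fixed (by simp) n
    rw [mandelbrotSet, Set.mem_ofPred_eq]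
    simp only [this, Set.range_const]
    exact Bornology.isBounded_singleton
  obtain ⟨δ, hδ, hball⟩ := Metric.isOpen_iff.mp hU 0 h0U
  -- The inverses of points outside `U`, together with `0` for `c = ∞`; adding `0` makes the set
  -- closed, and it is bounded because `U` contains a disc about `0`.
  set T : Set ℂ := {t | t ≠ 0 → t⁻¹ ∉ U}
  have hTclosed : IsClosed T := by
    have : T = ({0}ᶜ ∩ (fun t : ℂ => t⁻¹) ⁻¹' U)ᶜ := by
      ext t
      simp [T]
    rw [this, isClosed_compl_iff]
    exact ContinuousOn.isOpen_inter_preimage (continuousOn_inv₀ (G₀ := ℂ)) isOpen_compl_singleton hU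
  have hTcompact : IsCompact T := by
    refine (isCompact_closedBall (0 : ℂ) δ⁻¹).of_isClosed_subset hTclosed fun t ht => ?_
    rw [mem_closedBall_zero_iff]
    by_contra! hlt
    have h0 : 0 < ‖t‖ := (inv_pos.mpr hδ).trans hlt
    refine ht (norm_pos_iff.mp h0) (hball ?_)
    rw [mem_ball_zero_iff, norm_inv]
    exact inv_lt_of_inv_lt₀ hδ hlt
  have hev : ∀ᶠ n in Filter.atTop, ∀ t ∈ T, MandelbrotPoly.scaledCoeff t n ≠ 0 := by
    refine hTcompact.induction_on (p := fun S => ∀ᶠ n in Filter.atTop, ∀ t ∈ S,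
      MandelbrotPoly.scaledCoeff t n ≠ 0) (by simp) (fun S S' hSS' h => h.mono fun n hn t ht =>
        hn t (hSS' ht)) (fun S S' h h' => ?_) fun t ht => ?_
    · filter_upwards [h, h'] with n hn hn' t ht
      exact ht.elim (hn t) (hn' t)
    · have h := MandelbrotPoly.eventually_scaledCoeff_ne_zero (t₀ := t) fun ht0 hmem =>
        ht ht0 (hM hmem)
      obtain ⟨P, hP, Q, hQ, hPQ⟩ := Filter.eventually_prod_iff.mp h
      exact ⟨{t | P t}, mem_nhdsWithin_of_mem_nhds hP, hQ.mono fun n hn t ht => hPQ ht hn⟩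
  obtain ⟨N, hN⟩ := Filter.eventually_atTop.mp hev
  refine ⟨N, fun n hn c hc => ?_⟩
  have hc0 : c ≠ 0 := by
    rintro rfl
    exact hc h0U
  obtain ⟨k, rfl⟩ : ∃ k, n = k + 1 := ⟨n - 1, by omega⟩
  rw [MandelbrotPoly.aeval_mandelbrotPoly hc0]
  exact mul_ne_zero (pow_ne_zero _ hc0) (hN _ hn.le _ fun _ => by rwa [inv_inv])
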